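/- **Conventions.** Banach spaces are real, $\mathbb N=\{1,2,\dots\}$, "subspace" means infinite-dimensional subspace, and for finite sets $E<F$ means $\max E<\min F$. The Schreier families are $S_0=\{\{n\}:n\in\mathbb N\}\cup\{\emptyset\}$ and $S_{\xi+1}=\{\bigcup_{i=1}^nF_i:\ n\in\mathbb N,\ n\le\min F_1,\ F_1<\dots<F_n,\ F_i\in S_\xi\}\cup\{\emptyset\}$, $\xi<\omega$. A block basis of a sequence $(e_i)$ is a sequence of non-zero vectors $u_k=\sum_{i\in F_k}a_ie_i$ with $F_1<F_2<\cdots$ finite; the closed span of a block basis is a block subspace. A normalized sequence $(x_i)$ is an $\varepsilon$-$\ell_1^\xi$ spreading model ($\varepsilon>0$) if $\|\sum_{i\in F}a_ix_i\|\ge\varepsilon\sum_{i\in F}|a_i|$ for all $F\in S_\xi$ and all scalars $(a_i)$. A space with basis $(e_i)$ is asymptotic $\varepsilon$-$\ell_1^\xi$ ($1\le\xi<\omega$) if every normalized block basis of $(e_i)$ is an $\varepsilon$-$\ell_1^\xi$ spreading model. For the block subspace $U$ generated by a block basis $(u_i)$, $\tau(U,\delta)$ is the supremum of all $\zeta<\omega$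 such that every normalized block basis of $(u_i)$ has a subsequence which is a $\delta$-$\ell_1^\zeta$ spreading model ($\sup\emptyset=0$). Let $N=(n_i)$, $P=(p_i)$ be strictly increasing sequences in $\mathbb N$ with $p_i<n_i/2$ for all $i\ge1$ and $n_{i-1}\le p_i$ for all $i\ge2$, let $\mathbf a=(\delta_i)$ be a non-increasing null sequence of positive reals, and let $d>1$. A space $X$ with basis $(e_i)$ has the $(d,N,P,\mathbf a)$ distortion property if for every $j\in\mathbb N$ it is asymptotic $\delta_j$-$\ell_1^{n_j}$ and $\tau(U,d\delta_j)<p_j$ for every block subspace $U$ of $X$. A Banach space $(X,\|\cdot\|)$ is arbitrarily distortable if for every $\lambda>1$ there is an equivalent norm $|\cdot|$ on $X$ such that every subspace $Y$ of $X$ contains non-zero $x,y$ with $\|x\|=\|y\|$ and $|x|/|y|>\lambda$; we then say that $|\cdot|$ distorts $X$ by more than $\lambda$. **Theorem.** Let $(X,\|\cdot\|)$ be a Banach space with a normalized, shrinking, bimonotone basis $(e_i)$ (bimonotone: $\|P_n\|\le1$ and $\|I-P_n\|\le1$ for the basis projections $P_n$), with biorthogonal functionals $(e_i^*)$. Suppose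 that $X$ satisfies a $(d,N,P,\mathbf a)$ distortion property. Then $X$ is arbitrarily distortable. More precisely, for $j\in\mathbb N$ let $\mathcal A_j$ be the set of all functionals $\delta_j\sum_{i=1}^kx_i^*$, where $x_1^*,\dots,x_k^*$ is a finite block sequence of $(e_i^*)$ in the unit ball of $X^*$ which is $S_{n_j}$-admissible, i.e. the set of the minima of the supports of $x_1^*,\dots,x_k^*$ belongs to $S_{n_j}$, and put $$\|x\|_j=\delta_j\|x\|+\sup\{x^*(x):x^*\in\mathcal A_j\}.$$ Then for every $j$ these suprema are finite and $\|\cdot\|_j$ is an equivalent norm on $X$; and for every $\lambda>1$, for all sufficiently large $j$, the norm $\|\cdot\|_j$ distorts $X$ by more than $\lambda$. -/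

import Mathlib

open Filter Topology

/-- The Schreier families `S_ξ`, `ξ < ω`, of finite sets of positive integers. -/
def schreier : ℕ → Set (Finset ℕ)
  | 0 => {F | F = ∅ ∨ ∃ m : ℕ, 0 < m ∧ F = {m}}
  | ξ + 1 => {F | F = ∅ ∨ ∃ (n : ℕ) (G : Fin n → Finset ℕ),
      0 < n ∧
      (∀ i, G i ∈ schreier ξ ∧ (G i).Nonempty) ∧
      (∀ i j, i < j → ∀ s ∈ G i, ∀ t ∈ G j, s < t) ∧
      F = Finset.univ.biUnion G ∧
      ∀ s ∈ F, n ≤ s}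

/-- `u` is a block sequence of `e` with (nonempty, finite) successive supports `F`. The index set
`ι` is `ℕ` for infinite block sequences and `Fin k` for finite ones. -/
def IsBlockSeqOn {V ι : Type*} [AddCommGroup V] [Module ℝ V] [LT ι]
    (e : ℕ → V) (F : ι → Finset ℕ) (u : ι → V) : Prop :=
  (∀ i, (F i).Nonempty) ∧
  (∀ i j, i < j → ∀ s ∈ F i, ∀ t ∈ F j, s < t) ∧
  ∃ a : ℕ → ℝ, ∀ i, (∀ l ∈ F i, a l ≠ 0) ∧ u i = ∑ l ∈ F i, a l • e l

/-- `u` is a block basis of the (linearly independent) sequence `e`. -/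
def IsBlockBasis {V : Type*} [AddCommGroup V] [Module ℝ V] (e u : ℕ → V) : Prop :=
  ∃ F : ℕ → Finset ℕ, IsBlockSeqOn e F u

/-- All terms have norm one. -/
def IsNormalizedSeq {X : Type*} [NormedAddCommGroup X] (x : ℕ → X) : Prop :=
  ∀ n, ‖x n‖ = 1

/-- `x` is an `ε`-`ℓ₁^ξ` spreading model. Sequences are indexed from `0` in Lean and from `1` on
paper, so the `i`-th term, `i ≥ 1`, is `x (i - 1)`; members of `S_ξ` contain only `i ≥ 1`. -/
def IsEll1SpreadingModel {X : Type*} [NormedAddCommGroup X] [NormedSpace ℝ X]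
    (ε : ℝ) (ξ : ℕ) (x : ℕ → X) : Prop :=
  0 < ε ∧ IsNormalizedSeq x ∧
  ∀ F ∈ schreier ξ, ∀ a : ℕ → ℝ, ε * ∑ i ∈ F, |a i| ≤ ‖∑ i ∈ F, a i • x (i - 1)‖

/-- A space with basis `e` is asymptotic `ε`-`ℓ₁^ξ`. -/
def IsAsymptoticEll1 {X : Type*} [NormedAddCommGroup X] [NormedSpace ℝ X]
    (e : ℕ → X) (ε : ℝ) (ξ : ℕ) : Prop :=
  0 < ε ∧ 1 ≤ ξ ∧
  ∀ u : ℕ → X, IsBlockBasis e u → IsNormalizedSeq u → IsEll1SpreadingModel ε ξ u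

/-- The modulus `τ(U, δ)` of the space `U` generated by the sequence `u`, computed with respect
to `u`: the supremum of all `ζ < ω` such that every normalized block basis of `u` has a subsequence
which is a `δ`-`ℓ₁^ζ` spreading model. -/
noncomputable def tau {X : Type*} [NormedAddCommGroup X] [NormedSpace ℝ X]
    (u : ℕ → X) (δ : ℝ) : ℕ∞ :=
  sSup {t : ℕ∞ | ∃ ζ : ℕ, t = (ζ : ℕ∞) ∧
    ∀ v : ℕ → X, IsBlockBasis u v → IsNormalizedSeq v →
      ∃ φ : ℕ → ℕ, StrictMono φ ∧ IsEll1SpreadingModel δ ζ (v ∘ φ)}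

/-- The `(d, N, P, a)` distortion property, where `N = (n_i)`, `P = (p_i)`, `a = (δ_i)`; `n i`,
`p i`, `δ i` are the terms number `i + 1` on paper. -/
structure DistortionProperty {X : Type*} [NormedAddCommGroup X] [NormedSpace ℝ X]
    (b : SchauderBasis ℝ X) (d : ℝ) (n p : ℕ → ℕ) (δ : ℕ → ℝ) : Prop where
  one_lt_d : 1 < d
  strictMono_n : StrictMono n
  strictMono_p : StrictMono p
  p_pos : ∀ i, 0 < p i
  n_le_p_succ : ∀ i, n i ≤ p (i + 1)
  two_mul_p_lt_n : ∀ i, 2 * p i < n i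
  antitone_δ : Antitone δ
  tendsto_δ : Tendsto δ atTop (𝓝 0)
  asymptotic : ∀ j, IsAsymptoticEll1 b.basis (δ j) (n j)
  tau_lt : ∀ j, ∀ u : ℕ → X, IsBlockBasis b.basis u → tau u (d * δ j) < (p j : ℕ∞)

/-- The basis is bimonotone: the projections `P_n` and `I - P_n` (equivalently, the projections
onto intervals) have norm at most one. -/
def IsBimonotone {X : Type*} [NormedAddCommGroup X] [NormedSpace ℝ X]
    (b : SchauderBasis ℝ X) : Prop :=
  ∀ n, ‖SchauderBasis.proj b n‖ ≤ 1 ∧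
    ‖ContinuousLinearMap.id ℝ X - SchauderBasis.proj b n‖ ≤ 1

/-- The basis is shrinking: the biorthogonal functionals span a norm dense subspace of the dual. -/
def IsShrinking {X : Type*} [NormedAddCommGroup X] [NormedSpace ℝ X]
    (b : SchauderBasis ℝ X) : Prop :=
  (Submodule.span ℝ (Set.range b.coord)).topologicalClosure = ⊤

/-- `q` is an equivalent norm on `X`. -/
structure IsEquivalentNorm {X : Type*} [NormedAddCommGroup X] [NormedSpace ℝ X]
    (q : X → ℝ) : Prop where
  add_le : ∀ x y, q (x + y) ≤ q x + q y
  smul : ∀ (c : ℝ) (x : X), q (c • x) = |c| * q x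
  lower : ∃ c : ℝ, 0 < c ∧ ∀ x, c * ‖x‖ ≤ q x
  upper : ∃ C : ℝ, 0 < C ∧ ∀ x, q x ≤ C * ‖x‖

/-- The norm `q` distorts `X` by more than `r`: in every infinite-dimensional subspace `Y` there
are non-zero `x`, `y` with `‖x‖ = ‖y‖` and `q x / q y > r`. (By density it makes no difference
whether `Y` is required to be closed.) -/
def DistortsBy {X : Type*} [NormedAddCommGroup X] [NormedSpace ℝ X]
    (r : ℝ) (q : X → ℝ) : Prop :=
  ∀ Y : Submodule ℝ X, ¬ FiniteDimensional ℝ Y →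
    ∃ x ∈ Y, ∃ y ∈ Y, x ≠ 0 ∧ y ≠ 0 ∧ ‖x‖ = ‖y‖ ∧ r < q x / q y

/-- `X` is arbitrarily distortable. -/
def IsArbitrarilyDistortable (X : Type*) [NormedAddCommGroup X] [NormedSpace ℝ X] : Prop :=
  ∀ r : ℝ, 1 < r → ∃ q : X → ℝ, IsEquivalentNorm q ∧ DistortsBy r q

/-- The finite sequence of functionals `g` is `S_ξ`-admissible with respect to the biorthogonal
functionals: it is a finite block sequence of them, and the set of the minima of the supports
(shifted by one, since Lean indexes the basis from `0`) belongs to `S_ξ`. -/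
def IsAdmissible {X : Type*} [NormedAddCommGroup X] [NormedSpace ℝ X]
    (b : SchauderBasis ℝ X) (ξ : ℕ) {k : ℕ} (g : Fin k → StrongDual ℝ X) : Prop :=
  ∃ (F : Fin k → Finset ℕ) (h : ∀ i, (F i).Nonempty),
    IsBlockSeqOn b.coord F g ∧
    Finset.univ.image (fun i => (F i).min' (h i) + 1) ∈ schreier ξ

/-- The set `𝒜` of all `δ ∑ xᵢ*`, with `(xᵢ*)` an `S_ξ`-admissible finite sequence in the unit ball
of the dual. -/
def admissibleSums {X : Type*} [NormedAddCommGroup X] [NormedSpace ℝ X]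
    (b : SchauderBasis ℝ X) (δ : ℝ) (ξ : ℕ) : Set (StrongDual ℝ X) :=
  {f | ∃ (k : ℕ) (g : Fin k → StrongDual ℝ X),
    (∀ i, ‖g i‖ ≤ 1) ∧ IsAdmissible b ξ g ∧ f = δ • ∑ i, g i}

/-- The norm `δ ‖x‖ + sup {x*(x) : x* ∈ 𝒜}`. -/
noncomputable def distortingNorm {X : Type*} [NormedAddCommGroup X] [NormedSpace ℝ X]
    (b : SchauderBasis ℝ X) (δ : ℝ) (ξ : ℕ) (x : X) : ℝ :=
  δ * ‖x‖ + sSup ((fun f : StrongDual ℝ X => f x) '' admissibleSums b δ ξ)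

/-!
The norm `‖·‖_j = distortingNorm b (δ j) (n j)` distorts because every block subspace contains
normalized vectors `x` with `‖x‖_j ≥ 1 / d` and normalized vectors `y` with
`‖y‖_j ≤ (d + 2) * δ j`, and `δ j → 0`. A gliding hump (`exists_block_seq_near`) carries this over
to arbitrary infinite-dimensional subspaces, since `‖·‖_j` is an equivalent norm.

The vectors `x` (`exists_le_distortingNorm`). Since `τ < p j`, some normalized block sequence has a
combination `x = ∑ a i • v i` over a set in `S_{p j}` with `‖x‖ < d * δ j * ∑ |a i|`. The
functionals that norm the `v i` form an `S_{n j}`-admissible sequence, so `‖x‖_j ≥ δ j * ∑ |a i|`.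

The vectors `y` (`exists_sum_norm_ivl_le`). It suffices that the pieces of `y` over any
`S_{n j}`-admissible family of intervals have norms adding up to at most `d + 1`. If this failed for
all normalized vectors of a block subspace, take `k = j + 1` and a combination `∑ a i • v i` over a
set in `S_{p k}`, of norm less than `d * δ k * ∑ |a i|`. Cutting each `v i` into its admissible
pieces gives an `S_{p k + n j}`-admissible family whose norms add up to more than
`(d + 1) * ∑ |a i|`. As `p k + n j ≤ 2 * p k < n k`, this should contradict the lower estimate of
order `n k` with constant `δ k`.

The difficulty is that the asymptotic property is about the indices of a block basis, while
admissibility is about the minima of the supports, which are larger than the indices when pieces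
follow each other without gaps. One works therefore in a block subspace whose vectors vanish on
long intervals `[s a, 2 * s a + 2)`: cutting there as well inserts enough blocks to push the indices
up to the required size (`mul_sum_norm_ivl_le_of_cuts`, `mul_sum_sum_norm_ivl_le`). This needs that
no cut falls inside the remaining intervals. By passing to flat vectors, for which pieces over few
such intervals are negligible, the intervals that are cut can be deleted (`exists_uncut`). Flat
vectors of order `ξ` are obtained by induction on `ξ`, averaging successive flat vectors of smaller
order (`exists_isFlat`).

Without any care about constants, iterating the `S_1` estimate bounds `S_ξ`-admissible sums by
`(1 + δ⁻¹) ^ ξ * ‖x‖` (`sum_norm_ivl_le_of_mem_schreier`). This makes the suprema finite and the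
norms equivalent, and controls the small errors above.
-/

/-! ### Schreier families -/

lemma empty_mem_schreier (ξ : ℕ) : (∅ : Finset ℕ) ∈ schreier ξ := by
  cases ξ <;> exact Or.inl rfl

lemma pos_of_mem_schreier {ξ : ℕ} {F : Finset ℕ} (hF : F ∈ schreier ξ) : ∀ s ∈ F, 0 < s := by
  cases ξ with
  | zero =>
    rcases hF with rfl | ⟨m, hm, rfl⟩
    · simp
    · simpa using hm
  | succ ξ =>
    rcases hF with rfl | ⟨n, G, hn, -, -, -, h⟩
    · simp
    · exact fun s hs => hn.trans_le (h s hs)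

/-- Unlike in the definition of `S_{ξ + 1}`, some of the successive sets may be empty here. -/
lemma biUnion_mem_schreier_succ {ξ : ℕ} {J : Finset ℕ} {G : ℕ → Finset ℕ}
    (hG : ∀ j ∈ J, G j ∈ schreier ξ)
    (hlt : ∀ i ∈ J, ∀ j ∈ J, i < j → ∀ s ∈ G i, ∀ t ∈ G j, s < t)
    (hcard : ∀ s ∈ J.biUnion G, J.card ≤ s) : J.biUnion G ∈ schreier (ξ + 1) := by
  -- The empty members of the family are discarded, which only lowers their number.
  set K := J.filter fun j => (G j).Nonempty with hK
  have hKU : J.biUnion G = K.biUnion G := by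
    ext s
    simp only [Finset.mem_biUnion, hK, Finset.mem_filter]
    exact ⟨fun ⟨j, hj, hs⟩ => ⟨j, ⟨hj, s, hs⟩, hs⟩, fun ⟨j, hj, hs⟩ => ⟨j, hj.1, hs⟩⟩
  rcases K.eq_empty_or_nonempty with h0 | h0
  · left
    rw [hKU, h0, Finset.biUnion_empty]
  right
  refine ⟨K.card, fun i => G (K.orderEmbOfFin rfl i), h0.card_pos, fun i => ?_, fun i j hij => ?_,
    ?_, fun s hs => (Finset.card_filter_le _ _).trans (hcard s hs)⟩
  · have := Finset.mem_filter.1 (K.orderEmbOfFin_mem rfl i)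
    exact ⟨hG _ this.1, this.2⟩
  · exact hlt _ (Finset.mem_filter.1 (K.orderEmbOfFin_mem rfl i)).1 _
      (Finset.mem_filter.1 (K.orderEmbOfFin_mem rfl j)).1 ((K.orderEmbOfFin rfl).strictMono hij)
  · rw [hKU]
    ext s
    simp only [Finset.mem_biUnion, Finset.mem_univ, true_and]
    constructor
    · rintro ⟨j, hj, hs⟩
      have : j ∈ Set.range (K.orderEmbOfFin rfl) := by
        rw [Finset.range_orderEmbOfFin]; exact hj
      obtain ⟨i, rfl⟩ := this
      exact ⟨i, hs⟩
    · rintro ⟨i, hs⟩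
      exact ⟨_, K.orderEmbOfFin_mem rfl i, hs⟩

lemma exists_biUnion_of_mem_schreier_succ {ξ : ℕ} {F : Finset ℕ} (hF : F ∈ schreier (ξ + 1)) :
    ∃ (n : ℕ) (G : ℕ → Finset ℕ), (∀ j ∈ Finset.range n, G j ∈ schreier ξ) ∧
      (∀ i ∈ Finset.range n, ∀ j ∈ Finset.range n, i < j → ∀ s ∈ G i, ∀ t ∈ G j, s < t) ∧
      F = (Finset.range n).biUnion G ∧ ∀ s ∈ F, n ≤ s := by
  rcases hF with rfl | ⟨n, G, -, hG, hlt, rfl, hn⟩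
  · exact ⟨0, fun _ => ∅, by simp, by simp, by simp, by simp⟩
  · refine ⟨n, fun j => if h : j < n then G ⟨j, h⟩ else ∅, fun j hj => ?_, fun i hi j hj hij => ?_,
      ?_, hn⟩
    · simpa [Finset.mem_range.1 hj] using (hG ⟨j, Finset.mem_range.1 hj⟩).1
    · simpa [Finset.mem_range.1 hj, Finset.mem_range.1 hi] using
        hlt ⟨i, Finset.mem_range.1 hi⟩ ⟨j, Finset.mem_range.1 hj⟩ hij
    · ext s
      simp only [Finset.mem_biUnion, Finset.mem_univ, true_and, Finset.mem_range]
      constructor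
      · rintro ⟨i, hi⟩
        exact ⟨i, i.2, by simpa using hi⟩
      · rintro ⟨j, hj, hs⟩
        exact ⟨⟨j, hj⟩, by simpa [hj] using hs⟩

/-- The Schreier families are hereditary. -/
lemma schreier_subset {ξ : ℕ} {F F' : Finset ℕ} (hF : F ∈ schreier ξ) (h : F' ⊆ F) :
    F' ∈ schreier ξ := by
  induction ξ generalizing F F' with
  | zero =>
    rcases hF with rfl | ⟨m, hm, rfl⟩
    · exact Or.inl (Finset.subset_empty.1 h)
    · rcases Finset.subset_singleton_iff.1 h with rfl | rfl
      · exact Or.inl rfl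
      · exact Or.inr ⟨m, hm, rfl⟩
  | succ ξ ih =>
    obtain ⟨n, G, hG, hlt, rfl, hn⟩ := exists_biUnion_of_mem_schreier_succ hF
    have : F' = (Finset.range n).biUnion fun j => G j ∩ F' := by
      ext s
      simp only [Finset.mem_biUnion, Finset.mem_inter]
      refine ⟨fun hs => ?_, fun ⟨j, _, hs⟩ => hs.2⟩
      obtain ⟨j, hj, hs'⟩ := Finset.mem_biUnion.1 (h hs)
      exact ⟨j, hj, hs', hs⟩
    rw [this]
    refine biUnion_mem_schreier_succ (fun j hj => ih (hG j hj) Finset.inter_subset_left)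
      (fun i hi j hj hij s hs t ht => hlt i hi j hj hij s (Finset.mem_inter.1 hs).1 t
        (Finset.mem_inter.1 ht).1) fun s hs => ?_
    rw [← this] at hs
    simpa using hn s (h hs)

/-- A successive union of members of `S_ξ` indexed by a member of `S_ζ` whose elements lie below
the corresponding sets belongs to `S_{ξ + ζ}`. For `ξ = 0` this is the spreading property. -/
lemma biUnion_mem_schreier_add {ξ ζ : ℕ} {F : Finset ℕ} {G : ℕ → Finset ℕ} (hF : F ∈ schreier ζ)
    (hG : ∀ f ∈ F, G f ∈ schreier ξ) (hle : ∀ f ∈ F, ∀ s ∈ G f, f ≤ s)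
    (hlt : ∀ f ∈ F, ∀ f' ∈ F, f < f' → ∀ s ∈ G f, ∀ t ∈ G f', s < t) :
    F.biUnion G ∈ schreier (ξ + ζ) := by
  induction ζ generalizing F with
  | zero =>
    rcases hF with rfl | ⟨m, hm, rfl⟩
    · simpa using empty_mem_schreier _
    · simpa using hG m (by simp)
  | succ ζ ih =>
    obtain ⟨n, H, hH, hlt', rfl, hn⟩ := exists_biUnion_of_mem_schreier_succ hF
    have hsub : ∀ j ∈ Finset.range n, ∀ f ∈ H j, f ∈ (Finset.range n).biUnion H :=
      fun j hj f hf => Finset.mem_biUnion.2 ⟨j, hj, hf⟩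
    rw [Finset.biUnion_biUnion]
    refine biUnion_mem_schreier_succ (fun j hj => ih (hH j hj) (fun f hf => hG f (hsub j hj f hf))
      (fun f hf => hle f (hsub j hj f hf)) fun f hf f' hf' => hlt f (hsub j hj f hf) f'
        (hsub j hj f' hf')) (fun i hi j hj hij s hs t ht => ?_) fun s hs => ?_
    · obtain ⟨f, hf, hs⟩ := Finset.mem_biUnion.1 hs
      obtain ⟨f', hf', ht⟩ := Finset.mem_biUnion.1 ht
      exact hlt f (hsub i hi f hf) f' (hsub j hj f' hf') (hlt' i hi j hj hij f hf f' hf') s hs t ht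
    · obtain ⟨j, hj, hs⟩ := Finset.mem_biUnion.1 hs
      obtain ⟨f, hf, hs⟩ := Finset.mem_biUnion.1 hs
      rw [Finset.card_range]
      exact (hn f (hsub j hj f hf)).trans (hle f (hsub j hj f hf) s hs)

/-- The Schreier families are spreading. -/
lemma image_mem_schreier_of_le {ξ : ℕ} {L : Finset ℕ} {f g : ℕ → ℕ}
    (hf : StrictMonoOn f L) (hg : StrictMonoOn g L) (hfg : ∀ l ∈ L, f l ≤ g l)
    (h : L.image f ∈ schreier ξ) : L.image g ∈ schreier ξ := by
  have hinv : ∀ l ∈ L, Function.invFunOn f L (f l) = l := fun l hl =>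
    hf.injOn.leftInvOn_invFunOn hl
  have hgf : L.image g = (L.image f).biUnion fun x => {g (Function.invFunOn f L x)} := by
    ext s
    simp only [Finset.mem_image, Finset.mem_biUnion, Finset.mem_singleton, exists_exists_and_eq_and]
    constructor
    · rintro ⟨l, hl, rfl⟩
      exact ⟨l, hl, by rw [hinv l hl]⟩
    · rintro ⟨l, hl, rfl⟩
      exact ⟨l, hl, by rw [hinv l hl]⟩
  rw [hgf]
  have hz : ξ = 0 + ξ := (zero_add ξ).symm
  rw [hz]
  refine biUnion_mem_schreier_add h ?_ ?_ ?_
  · intro x hx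
    obtain ⟨l, hl, rfl⟩ := Finset.mem_image.1 hx
    rw [hinv l hl]
    exact Or.inr ⟨g l, (pos_of_mem_schreier h _ hx).trans_le (hfg l hl), rfl⟩
  · intro x hx s hs
    obtain ⟨l, hl, rfl⟩ := Finset.mem_image.1 hx
    rw [hinv l hl, Finset.mem_singleton] at hs
    exact hs ▸ hfg l hl
  · intro x hx y hy hxy s hs t ht
    obtain ⟨l, hl, rfl⟩ := Finset.mem_image.1 hx
    obtain ⟨m, hm, rfl⟩ := Finset.mem_image.1 hy
    rw [hinv l hl, Finset.mem_singleton] at hs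
    rw [hinv m hm, Finset.mem_singleton] at ht
    subst hs ht
    exact hg hl hm ((hf.lt_iff_lt hl hm).1 hxy)

lemma schreier_le {ξ ζ : ℕ} (h : ξ ≤ ζ) : schreier ξ ⊆ schreier ζ := by
  induction ζ, h using Nat.le_induction with
  | base => exact subset_rfl
  | succ ζ _ ih =>
    refine ih.trans fun F hF => ?_
    have hF' : F = ({0} : Finset ℕ).biUnion fun _ => F := by simp
    rw [hF']
    refine biUnion_mem_schreier_succ (fun _ _ => hF) (by simp) fun s hs => ?_
    rw [← hF'] at hs
    rw [Finset.card_singleton]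
    exact pos_of_mem_schreier hF s hs

lemma mem_schreier_one {F : Finset ℕ} (hF : ∀ s ∈ F, F.card ≤ s) : F ∈ schreier 1 := by
  have hF' : F = F.biUnion fun s => {s} := by simp
  rw [hF']
  refine biUnion_mem_schreier_succ (fun j hj => Or.inr ⟨j, ?_, rfl⟩) (by simp) fun s hs => ?_
  · exact (Finset.card_pos.2 ⟨j, hj⟩).trans_le (hF j hj)
  · rw [← hF'] at hs
    exact hF s hs

/-! ### Interval projections and lower estimates -/

section Intervals

variable {X : Type*} [NormedAddCommGroup X] [NormedSpace ℝ X] (b : SchauderBasis ℝ X)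

/-- The basis projection onto the coordinates in the interval `[a, c)`. -/
noncomputable def ivl (a c : ℕ) : X →L[ℝ] X := GeneralSchauderBasis.proj b (Finset.Ico a c)

lemma ivl_apply (a c : ℕ) (x : X) :
    ivl b a c x = ∑ i ∈ Finset.Ico a c, b.coord i x • b.basis i := by
  simp [ivl]

lemma coord_basis (i j : ℕ) : b.coord i (b.basis j) = if i = j then 1 else 0 := by
  rw [b.ortho]
  rcases eq_or_ne i j with rfl | h
  · simp
  · simp [h]

lemma coord_ivl (a c i : ℕ) (x : X) :
    b.coord i (ivl b a c x) = if a ≤ i ∧ i < c then b.coord i x else 0 := by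
  simp [ivl_apply, map_sum, coord_basis]

variable {b} in
/-- A vector is determined by its coordinates. -/
lemma ext_coord {x y : X} (h : ∀ i, b.coord i x = b.coord i y) : x = y := by
  refine tendsto_nhds_unique (SchauderBasis.tendsto_proj b x) ?_
  have : (fun n => SchauderBasis.proj b n x) = fun n => SchauderBasis.proj b n y := by
    funext n
    simp [h]
  rw [this]
  exact SchauderBasis.tendsto_proj b y

lemma proj_eq_ivl (n : ℕ) (x : X) : SchauderBasis.proj b n x = ivl b 0 n x := by
  simp [ivl_apply]

lemma ivl_ivl {a c a' c' : ℕ} (ha : a ≤ a') (hc : c' ≤ c) (x : X) :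
    ivl b a' c' (ivl b a c x) = ivl b a' c' x := by
  refine ext_coord (b := b) fun i => ?_
  simp only [coord_ivl]
  split_ifs <;> first | rfl | omega

lemma ivl_eq_self_iff {a c : ℕ} {x : X} :
    ivl b a c x = x ↔ ∀ i, (i < a ∨ c ≤ i) → b.coord i x = 0 := by
  constructor
  · intro h i hi
    rw [← h, coord_ivl, if_neg (by omega)]
  · intro h
    refine ext_coord (b := b) fun i => ?_
    rw [coord_ivl]
    split_ifs with hi
    · rfl
    · exact (h i (by omega)).symm

lemma ivl_mono_self {a c a' c' : ℕ} {x : X} (h : ivl b a c x = x) (ha : a' ≤ a) (hc : c ≤ c') :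
    ivl b a' c' x = x :=
  (ivl_eq_self_iff b).2 fun i hi => (ivl_eq_self_iff b).1 h i (by omega)

variable {b} (hb : IsBimonotone b)
include hb

lemma norm_ivl_le (a c : ℕ) (x : X) : ‖ivl b a c x‖ ≤ ‖x‖ := by
  have h : ivl b a c x =
      (ContinuousLinearMap.id ℝ X - SchauderBasis.proj b a) (SchauderBasis.proj b c x) := by
    refine ext_coord (b := b) fun i => ?_
    rw [sub_apply, ContinuousLinearMap.id_apply, map_sub]
    simp only [proj_eq_ivl, coord_ivl]
    split_ifs <;> first | omega | simp
  rw [h]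
  calc _ ≤ 1 * ‖SchauderBasis.proj b c x‖ := ContinuousLinearMap.le_of_opNorm_le _ (hb a).2 _
    _ ≤ 1 * (1 * ‖x‖) := by gcongr; exact ContinuousLinearMap.le_of_opNorm_le _ (hb c).1 _
    _ = ‖x‖ := by ring

lemma norm_ivl_mono {a c a' c' : ℕ} (ha : a ≤ a') (hc : c' ≤ c) (x : X) :
    ‖ivl b a' c' x‖ ≤ ‖ivl b a c x‖ := by
  rw [← ivl_ivl b ha hc x]
  exact norm_ivl_le hb _ _ _

end Intervals

section Blocks

variable {X : Type*} [NormedAddCommGroup X] [NormedSpace ℝ X] {b : SchauderBasis ℝ X}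

/-- The coefficients of a block sequence may be given term by term, since the supports are
disjoint. -/
lemma isBlockSeqOn_of_coeff {V ι : Type*} [AddCommGroup V] [Module ℝ V] [LinearOrder ι]
    {e : ℕ → V} {F : ι → Finset ℕ} {u : ι → V} {a : ι → ℕ → ℝ} (hne : ∀ i, (F i).Nonempty)
    (hlt : ∀ i j, i < j → ∀ s ∈ F i, ∀ t ∈ F j, s < t) (ha : ∀ i, ∀ l ∈ F i, a i l ≠ 0)
    (hu : ∀ i, u i = ∑ l ∈ F i, a i l • e l) : IsBlockSeqOn e F u := by
  classical
  have huniq : ∀ i j c, c ∈ F i → c ∈ F j → i = j := fun i j c hi hj => by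
    rcases lt_trichotomy i j with hij | hij | hij
    · exact absurd (hlt i j hij c hi c hj) (lt_irrefl _)
    · exact hij
    · exact absurd (hlt j i hij c hj c hi) (lt_irrefl _)
  let a' : ℕ → ℝ := fun c => if hc : ∃ i, c ∈ F i then a hc.choose c else 0
  have ha' : ∀ i, ∀ l ∈ F i, a' l = a i l := fun i l hl => by
    have hc : ∃ i, l ∈ F i := ⟨i, hl⟩
    simp only [a', dif_pos hc]
    rw [huniq _ _ l hc.choose_spec hl]
  refine ⟨hne, hlt, a', fun i => ⟨fun l hl => ?_, ?_⟩⟩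
  · rw [ha' i l hl]
    exact ha i l hl
  · rw [hu i]
    exact Finset.sum_congr rfl fun l hl => by rw [ha' i l hl]

/-- Non-zero vectors with successive supports, contained in the intervals `[N i, N (i + 1))`,
form a block basis. -/
lemma isBlockBasis_of_ivl {x : ℕ → X} {N : ℕ → ℕ} (hN : Monotone N) (hx : ∀ i, x i ≠ 0)
    (h : ∀ i, ivl b (N i) (N (i + 1)) (x i) = x i) : IsBlockBasis b.basis x := by
  classical
  have hsum : ∀ i, x i = ∑ l ∈ (Finset.Ico (N i) (N (i + 1))).filter
      (fun c => b.coord c (x i) ≠ 0), b.coord l (x i) • b.basis l := fun i => by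
    conv_lhs => rw [← h i, ivl_apply]
    rw [Finset.sum_filter_of_ne]
    intro c _ hc h0
    exact hc (by rw [h0, zero_smul])
  refine ⟨_, isBlockSeqOn_of_coeff (fun i => ?_) (fun i j hij s hs t ht => ?_)
    (fun i l hl => (Finset.mem_filter.1 hl).2) hsum⟩
  · rw [Finset.nonempty_iff_ne_empty]
    intro h0
    apply hx i
    rw [hsum i, h0, Finset.sum_empty]
  · have h1 := Finset.mem_Ico.1 (Finset.mem_filter.1 hs).1
    have h2 := Finset.mem_Ico.1 (Finset.mem_filter.1 ht).1
    exact (h1.2.trans_le (hN hij)).trans_le h2.1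

variable {ε : ℝ} {M : ℕ} (hnorm : IsNormalizedSeq b.basis) (hA : IsAsymptoticEll1 b.basis ε M)
include hnorm hA

/-- Lower `ℓ₁` estimate for the pieces of a vector cut at the points `t 0 < t 1 < ⋯`. A vanishing
piece is replaced by a basis vector when the pieces are completed to a block basis. -/
lemma mul_sum_norm_ivl_le {t : ℕ → ℕ} (ht : StrictMono t) {F : Finset ℕ} (hF : F ∈ schreier M)
    (x : X) : ε * ∑ i ∈ F, ‖ivl b (t (i - 1)) (t (i - 1 + 1)) x‖ ≤
      ‖∑ i ∈ F, ivl b (t (i - 1)) (t (i - 1 + 1)) x‖ := by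
  classical
  set y : ℕ → X := fun l => ivl b (t l) (t (l + 1)) x with hy
  let u : ℕ → X := fun l => if y l = 0 then b.basis (t l) else ‖y l‖⁻¹ • y l
  have hu1 : IsNormalizedSeq u := fun l => by
    by_cases h0 : y l = 0
    · simp only [u, if_pos h0]; exact hnorm _
    · simp only [u, if_neg h0]
      rw [norm_smul, norm_inv, norm_norm, inv_mul_cancel₀ (norm_ne_zero_iff.2 h0)]
  have hyu : ∀ l, ‖y l‖ • u l = y l := fun l => by
    by_cases h0 : y l = 0
    · simp [h0]
    · simp only [u, if_neg h0]
      rw [smul_smul, mul_inv_cancel₀ (norm_ne_zero_iff.2 h0), one_smul]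
  have hub : IsBlockBasis b.basis u := by
    refine isBlockBasis_of_ivl (N := t) ht.monotone (fun l h0 => ?_) fun l => ?_
    · have := hu1 l
      rw [h0, norm_zero] at this
      exact zero_ne_one this
    · by_cases h0 : y l = 0
      · simp only [u, if_pos h0]
        refine (ivl_eq_self_iff b).2 fun i hi => ?_
        have := ht (Nat.lt_add_one l)
        rw [coord_basis, if_neg]
        rintro rfl
        omega
      · simp only [u, if_neg h0]
        rw [map_smul, hy]
        simp only
        rw [ivl_ivl b le_rfl le_rfl]
  have := (hA.2.2 u hub hu1).2.2 F hF fun i => ‖y (i - 1)‖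
  simpa only [abs_norm, hyu] using this

/-- Lower `ℓ₁` estimate for the pieces `[c l, R l)`, `l ∈ L`, of a vector `x`. The set `T` of cut
points contains all `c l`, and the position of the piece starting at `c l` in the resulting block
basis is one more than the number of cut points below `c l`. The last hypothesis says that, between
the first `c l` and `N`, the pieces starting at other cut points vanish on `x`. -/
lemma mul_sum_norm_ivl_le_of_cuts (hb : IsBimonotone b) {ι : Type*} {T : ℕ → Prop}
    [DecidablePred T] {N : ℕ} (hTN : ∀ τ, N ≤ τ → T τ) {L : Finset ι} {c R : ι → ℕ}
    (hinj : Set.InjOn c L) (hcT : ∀ l ∈ L, T (c l)) (hcN : ∀ l ∈ L, c l < N)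
    (hR : ∀ l ∈ L, ∀ τ, T τ → c l < τ → R l ≤ τ)
    (hS : L.image (fun l => Nat.count T (c l) + 1) ∈ schreier M) {x : X}
    (hx : ∀ i, b.coord i x ≠ 0 → (∀ l ∈ L, i < c l) ∨ N ≤ i ∨
      ∃ l ∈ L, c l ≤ i ∧ ∀ τ, T τ → c l < τ → i < τ) :
    ε * ∑ l ∈ L, ‖ivl b (c l) (R l) x‖ ≤ ‖x‖ := by
  classical
  have hT : (Set.ofPred T).Infinite :=
    Set.infinite_of_not_bddAbove fun ⟨B, hB⟩ => by
      have := hB (show T (max N B + 1) from hTN _ (by omega))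
      omega
  have hmono := Nat.nth_strictMono hT
  have hnth : ∀ l ∈ L, Nat.nth T (Nat.count T (c l)) = c l := fun l hl => Nat.nth_count (hcT l hl)
  set nx : ι → ℕ := fun l => Nat.nth T (Nat.count T (c l) + 1) with hnx
  have hnxT : ∀ l, T (nx l) := fun l => Nat.nth_mem_of_infinite hT _
  have hcnx : ∀ l ∈ L, c l < nx l := fun l hl => by
    have := hmono (Nat.lt_add_one (Nat.count T (c l)))
    rwa [hnth l hl] at this
  have hnx_le : ∀ l ∈ L, ∀ τ, T τ → c l < τ → nx l ≤ τ := fun l hl τ hτ hlt => by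
    have h1 := Nat.count_strict_mono (hcT l hl) hlt
    have := hmono.monotone (Nat.succ_le_of_lt h1)
    rwa [Nat.nth_count hτ] at this
  have hposinj : Set.InjOn (fun l => Nat.count T (c l) + 1) (L : Set ι) := fun l hl l' hl' h =>
    hinj hl hl' (Nat.count_injective (hcT l hl) (hcT l' hl') (Nat.succ_injective h))
  have key := mul_sum_norm_ivl_le hnorm hA hmono hS x
  rw [Finset.sum_image hposinj, Finset.sum_image hposinj] at key
  simp only [Nat.add_sub_cancel] at key
  have e1 : ∀ l ∈ L, ivl b (Nat.nth T (Nat.count T (c l)))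
      (Nat.nth T (Nat.count T (c l) + 1)) x = ivl b (c l) (nx l) x := fun l hl => by rw [hnth l hl]
  rw [Finset.sum_congr rfl e1, Finset.sum_congr rfl fun l hl => congrArg norm (e1 l hl)] at key
  have hsum : ‖∑ l ∈ L, ivl b (c l) (nx l) x‖ ≤ ‖x‖ := by
    rcases L.eq_empty_or_nonempty with rfl | hL
    · simp
    obtain ⟨l₀, hl₀, hmin⟩ := L.exists_min_image c hL
    suffices h : ∑ l ∈ L, ivl b (c l) (nx l) x = ivl b (c l₀) N x by
      rw [h]; exact norm_ivl_le hb _ _ _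
    refine ext_coord (b := b) fun i => ?_
    rw [map_sum]
    simp only [coord_ivl]
    by_cases hi0 : b.coord i x = 0
    · simp [hi0]
    by_cases hi : c l₀ ≤ i ∧ i < N
    · rw [if_pos hi]
      obtain h | h | ⟨l, hl, hli, hlτ⟩ := hx i hi0
      · have := h l₀ hl₀; omega
      · omega
      · rw [Finset.sum_eq_single l]
        · rw [if_pos ⟨hli, hlτ _ (hnxT l) (hcnx l hl)⟩]
        · intro l' hl' hne
          rw [if_neg]
          rintro ⟨h1, h2⟩
          rcases lt_trichotomy (c l) (c l') with h | h | h
          · have := hlτ _ (hcT l' hl') h; omega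
          · exact hne (hinj hl' hl h.symm)
          · have := hnx_le l' hl' _ (hcT l hl) h; omega
        · exact fun h => absurd hl h
    · rw [if_neg hi]
      refine Finset.sum_eq_zero fun l hl => if_neg ?_
      rintro ⟨h1, h2⟩
      have h3 := hmin l hl
      have h4 := hnx_le l hl N (hTN N le_rfl) (hcN l hl)
      omega
  refine le_trans (mul_le_mul_of_nonneg_left (Finset.sum_le_sum fun l hl => ?_) hA.1.le)
    (key.trans hsum)
  exact norm_ivl_mono hb le_rfl (hR l hl _ (hnxT l) (hcnx l hl)) x

/-- Lower `ℓ₁` estimate for at most `min + 1` successive intervals. All points below the first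
interval are used as cut points, so that the positions of the intervals exceed their number. -/
lemma mul_sum_norm_ivl_le_of_card (hb : IsBimonotone b) {L : Finset ℕ} {c R : ℕ → ℕ}
    (hcR : ∀ l ∈ L, c l < R l) (hsep : ∀ l ∈ L, ∀ l' ∈ L, l < l' → R l ≤ c l')
    (hcard : ∀ l ∈ L, L.card ≤ c l + 1) (x : X) :
    ε * ∑ l ∈ L, ‖ivl b (c l) (R l) x‖ ≤ ‖x‖ := by
  classical
  rcases L.eq_empty_or_nonempty with rfl | hL
  · simp
  obtain ⟨l₀, hl₀, hmin⟩ := L.exists_min_image id hL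
  have hle : ∀ l ∈ L, c l₀ ≤ c l := fun l hl => by
    rcases (hmin l hl).eq_or_lt with h | h
    · simp only [id] at h; rw [h]
    · exact (hcR l₀ hl₀).le.trans (hsep _ hl₀ _ hl h)
  set N := L.sup R
  have hRN : ∀ l ∈ L, R l ≤ N := fun l hl => Finset.le_sup hl
  have hstrict : ∀ l ∈ L, ∀ l' ∈ L, l < l' → c l < c l' := fun l hl l' hl' h =>
    (hcR l hl).trans_le (hsep l hl l' hl' h)
  have hlt : ∀ l ∈ L, ∀ l' ∈ L, c l < c l' → R l ≤ c l' := fun l hl l' hl' h => by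
    rcases lt_trichotomy l l' with h' | rfl | h'
    · exact hsep l hl l' hl' h'
    · exact absurd h (lt_irrefl _)
    · exact absurd (hstrict l' hl' l hl h') h.asymm
  refine mul_sum_norm_ivl_le_of_cuts hnorm hA hb
    (T := fun s => s < c l₀ ∨ (∃ l ∈ L, s = c l) ∨ N ≤ s) (N := N)
    (fun τ hτ => Or.inr (Or.inr hτ)) ?_ (fun l hl => Or.inr (Or.inl ⟨l, hl, rfl⟩))
    (fun l hl => (hcR l hl).trans_le (hRN l hl)) ?_ ?_ ?_
  · intro l hl l' hl' h
    rcases lt_trichotomy l l' with h' | h' | h'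
    · exact absurd h (hstrict l hl l' hl' h').ne
    · exact h'
    · exact absurd h (hstrict l' hl' l hl h').ne'
  · rintro l hl τ (h | ⟨l', hl', rfl⟩ | h) hτ
    · have := hle l hl; omega
    · exact hlt l hl l' hl' hτ
    · exact (hRN l hl).trans h
  · refine schreier_le hA.2.1 (mem_schreier_one fun s hs => ?_)
    obtain ⟨l, hl, rfl⟩ := Finset.mem_image.1 hs
    refine (Finset.card_image_le.trans (hcard l₀ hl₀)).trans (Nat.succ_le_succ ?_)
    calc c l₀ = Nat.count (fun s => s < c l₀ ∨ (∃ l ∈ L, s = c l) ∨ N ≤ s) (c l₀) :=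
          (Nat.count_iff_forall.2 fun n' hn' => Or.inl hn').symm
      _ ≤ _ := Nat.count_monotone _ (hle l hl)
  · intro i _
    by_cases h1 : i < c l₀
    · exact Or.inl fun l hl => h1.trans_le (hle l hl)
    by_cases h2 : N ≤ i
    · exact Or.inr (Or.inl h2)
    refine Or.inr (Or.inr ?_)
    obtain ⟨l, hl, hmax⟩ := (L.filter fun l => c l ≤ i).exists_max_image c
      ⟨l₀, Finset.mem_filter.2 ⟨hl₀, not_lt.1 h1⟩⟩
    rw [Finset.mem_filter] at hl
    refine ⟨l, hl.1, hl.2, ?_⟩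
    rintro τ (h | ⟨l', hl', rfl⟩ | h) hτ
    · have := hle l hl.1; omega
    · by_contra h
      have := hmax l' (Finset.mem_filter.2 ⟨hl', not_lt.1 h⟩)
      omega
    · omega

/-- Upper bound for the norms of pieces of a vector whose end points form a set in `S_ξ`, with a
constant that depends on `ξ`: the `S_1` estimate is iterated. -/
lemma sum_norm_ivl_le_of_mem_schreier (hb : IsBimonotone b) {ξ : ℕ} {t : ℕ → ℕ} (ht : StrictMono t)
    {L : Finset ℕ} (hL : L.image (fun l => t (l + 1)) ∈ schreier ξ) (x : X) :
    ∑ l ∈ L, ‖ivl b (t l) (t (l + 1)) x‖ ≤ (1 + ε⁻¹) ^ ξ * ‖x‖ := by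
  classical
  have hε := hA.1
  have hinj : Function.Injective fun l => t (l + 1) := fun l l' h =>
    Nat.succ_injective (ht.injective h)
  induction ξ generalizing L x with
  | zero =>
    rcases hL with h | ⟨m, -, h⟩
    · rw [Finset.image_eq_empty.1 h]; simp
    · have hc : L.card = 1 := by
        rw [← Finset.card_image_of_injective L hinj, h, Finset.card_singleton]
      obtain ⟨l, rfl⟩ := Finset.card_eq_one.1 hc
      simpa using norm_ivl_le hb _ _ x
  | succ ξ ih =>
    obtain ⟨n, G, hG, hlt, hLG, hn⟩ := exists_biUnion_of_mem_schreier_succ hL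
    set H : ℕ → Finset ℕ := fun j => L.filter fun l => t (l + 1) ∈ G j with hH
    set J := (Finset.range n).filter fun j => (H j).Nonempty with hJ
    have hHlt : ∀ i ∈ J, ∀ j ∈ J, i < j → ∀ l ∈ H i, ∀ l' ∈ H j, l < l' := by
      intro i hi j hj hij l hl l' hl'
      have := hlt i (Finset.mem_filter.1 hi).1 j (Finset.mem_filter.1 hj).1 hij _
        (Finset.mem_filter.1 hl).2 _ (Finset.mem_filter.1 hl').2
      have := ht.lt_iff_lt.1 this
      omega
    have hex : ∀ j, ∃ lo hi, j ∈ J → lo ∈ H j ∧ hi ∈ H j ∧ ∀ l ∈ H j, lo ≤ l ∧ l ≤ hi := by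
      intro j
      by_cases hj : j ∈ J
      · have hne := (Finset.mem_filter.1 hj).2
        exact ⟨(H j).min' hne, (H j).max' hne, fun _ => ⟨Finset.min'_mem _ _, Finset.max'_mem _ _,
          fun l hl => ⟨Finset.min'_le _ _ hl, Finset.le_max' _ _ hl⟩⟩⟩
      · exact ⟨0, 0, fun h => absurd h hj⟩
    choose lo hi hlohi using hex
    have hLJ : L = J.biUnion H := by
      ext l
      simp only [Finset.mem_biUnion]
      constructor
      · intro hl
        have : t (l + 1) ∈ L.image fun l => t (l + 1) := Finset.mem_image_of_mem _ hl
        rw [hLG] at this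
        obtain ⟨j, hj, hlj⟩ := Finset.mem_biUnion.1 this
        have hlH : l ∈ H j := Finset.mem_filter.2 ⟨hl, hlj⟩
        exact ⟨j, Finset.mem_filter.2 ⟨hj, l, hlH⟩, hlH⟩
      · rintro ⟨j, _, hl⟩
        exact (Finset.mem_filter.1 hl).1
    have hdisj : (J : Set ℕ).PairwiseDisjoint H := by
      intro i hi j hj hij
      rw [Function.onFun, Finset.disjoint_left]
      intro l hl hl'
      rcases lt_or_gt_of_ne hij with h | h
      · exact lt_irrefl _ (hHlt i hi j hj h l hl l hl')
      · exact lt_irrefl _ (hHlt j hj i hi h l hl' l hl)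
    set c : ℕ → ℕ := fun j => t (lo j) with hc
    set R : ℕ → ℕ := fun j => t (hi j + 1) with hR
    have step : ∀ j ∈ J, ∑ l ∈ H j, ‖ivl b (t l) (t (l + 1)) x‖ ≤
        (1 + ε⁻¹) ^ ξ * ‖ivl b (c j) (R j) x‖ := by
      intro j hj
      have hsub : (H j).image (fun l => t (l + 1)) ∈ schreier ξ := by
        refine schreier_subset (hG j (Finset.mem_filter.1 hj).1) fun s hs => ?_
        obtain ⟨l, hl, rfl⟩ := Finset.mem_image.1 hs
        exact (Finset.mem_filter.1 hl).2
      refine le_trans (Finset.sum_le_sum fun l hl => ?_) (ih hsub (ivl b (c j) (R j) x))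
      have := (hlohi j hj).2.2 l hl
      rw [ivl_ivl b (ht.monotone this.1) (ht.monotone (Nat.succ_le_succ this.2))]
    have blocks : ∑ j ∈ J, ‖ivl b (c j) (R j) x‖ ≤ (1 + ε⁻¹) * ‖x‖ := by
      rcases J.eq_empty_or_nonempty with h0 | h0
      · rw [h0, Finset.sum_empty]; positivity
      obtain ⟨j₀, hj₀, hmin⟩ := J.exists_min_image id h0
      rw [← Finset.add_sum_erase _ _ hj₀, add_mul, one_mul]
      -- The first block may start before `n`. The others start at or after the end point of a piece
      -- in the first one, and such end points are at least `n`.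
      refine add_le_add (norm_ivl_le hb _ _ x) ?_
      rw [inv_mul_eq_div, le_div_iff₀' hε]
      refine mul_sum_norm_ivl_le_of_card hnorm hA hb (fun j hj => ?_) (fun j hj j' hj' h => ?_)
        (fun j hj => ?_) x
      · have := hlohi j (Finset.mem_of_mem_erase hj)
        exact ht (Nat.lt_succ_of_le (this.2.2 _ this.1).2)
      · have hj := Finset.mem_of_mem_erase hj
        have hj' := Finset.mem_of_mem_erase hj'
        exact ht.monotone (hHlt j hj j' hj' h _ (hlohi j hj).2.1 _ (hlohi j' hj').1)
      · have hj' := Finset.mem_of_mem_erase hj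
        have hjj : j₀ < j := lt_of_le_of_ne (hmin j hj') (Finset.ne_of_mem_erase hj).symm
        have h1 := hHlt j₀ hj₀ j hj' hjj _ (hlohi j₀ hj₀).1 _ (hlohi j hj').1
        have h2 : n ≤ t (lo j₀ + 1) :=
          hn _ (Finset.mem_image_of_mem _ (Finset.mem_filter.1 (hlohi j₀ hj₀).1).1)
        have h3 : t (lo j₀ + 1) ≤ t (lo j) := ht.monotone h1
        have h4 : (J.erase j₀).card ≤ n := by
          refine (Finset.card_le_card (Finset.erase_subset _ _)).trans ?_
          simpa using Finset.card_filter_le (Finset.range n) fun j => (H j).Nonempty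
        simp only [hc]
        omega
    rw [hLJ, Finset.sum_biUnion hdisj]
    calc _ ≤ ∑ j ∈ J, (1 + ε⁻¹) ^ ξ * ‖ivl b (c j) (R j) x‖ := Finset.sum_le_sum step
      _ = (1 + ε⁻¹) ^ ξ * ∑ j ∈ J, ‖ivl b (c j) (R j) x‖ := by rw [Finset.mul_sum]
      _ ≤ (1 + ε⁻¹) ^ ξ * ((1 + ε⁻¹) * ‖x‖) := by gcongr
      _ = _ := by ring

end Blocks

/-! ### Flat vectors -/

/-- Recursive choice of a sequence `x` along a strictly increasing sequence `A` of thresholds. -/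
lemma exists_seq_of_step {α : Type*} {Q : ℕ → ℕ → α → ℕ → Prop} (a₀ : ℕ)
    (h : ∀ i a, ∃ x a', a < a' ∧ Q i a x a') :
    ∃ (x : ℕ → α) (A : ℕ → ℕ), A 0 = a₀ ∧ StrictMono A ∧ ∀ i, Q i (A i) (x i) (A (i + 1)) := by
  choose x a' hlt hQ using h
  let A : ℕ → ℕ := fun i => Nat.rec a₀ (fun i a => a' i a) i
  exact ⟨fun i => x i (A i), A, rfl, strictMono_nat_of_lt_succ fun i => hlt i (A i),
    fun i => hQ i (A i)⟩

section Flat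

variable {X : Type*} [NormedAddCommGroup X] [NormedSpace ℝ X]

/-- The vector `x`, cut into its pieces over the intervals `[s a, s (a + 1))`, is `ε`-flat of
order `ξ`: the norms of pieces whose end points form a set in `S_ξ` add up to at most `ε`. -/
def IsFlat (b : SchauderBasis ℝ X) (s : ℕ → ℕ) (ξ : ℕ) (ε : ℝ) (x : X) : Prop :=
  ∀ G : Finset ℕ, G.image (fun a => s (a + 1)) ∈ schreier ξ →
    ∑ a ∈ G, ‖ivl b (s a) (s (a + 1)) x‖ ≤ ε

/-- The space `U` contains non-zero vectors with finite support arbitrarily far out. -/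
def HasBlocks (b : SchauderBasis ℝ X) (U : Submodule ℝ X) : Prop :=
  ∀ N, ∃ x ∈ U, x ≠ 0 ∧ ∃ N', ivl b N N' x = x

variable {b : SchauderBasis ℝ X}

/-- Restricting a combination of successive vectors to one of their intervals selects one term. -/
lemma ivl_sum_smul_eq {N : ℕ → ℕ} (hN : Monotone N) {z : ℕ → X}
    (hz : ∀ i, ivl b (N i) (N (i + 1)) (z i) = z i) (F : Finset ℕ) (a : ℕ → ℝ) {l : ℕ}
    (hl : l ∈ F) : ivl b (N l) (N (l + 1)) (∑ i ∈ F, a i • z i) = a l • z l := by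
  rw [map_sum, Finset.sum_eq_single l]
  · rw [map_smul, hz]
  · intro i _ hne
    refine ext_coord (b := b) fun c => ?_
    rw [map_smul, map_smul, coord_ivl, map_zero, smul_eq_mul]
    split_ifs with hc
    · rw [(ivl_eq_self_iff b).1 (hz i) c, mul_zero]
      rcases lt_or_gt_of_ne hne with h | h
      · have := hN (Nat.succ_le_of_lt h)
        simp only [Nat.succ_eq_add_one] at this
        omega
      · have := hN (Nat.succ_le_of_lt h)
        simp only [Nat.succ_eq_add_one] at this
        omega
    · simp
  · exact fun h => absurd hl h

lemma abs_coeff_le_norm (hb : IsBimonotone b) {N : ℕ → ℕ} (hN : Monotone N) {z : ℕ → X}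
    (hz : ∀ i, ivl b (N i) (N (i + 1)) (z i) = z i) (hz1 : ∀ i, ‖z i‖ = 1) (F : Finset ℕ)
    (a : ℕ → ℝ) {l : ℕ} (hl : l ∈ F) : |a l| ≤ ‖∑ i ∈ F, a i • z i‖ := by
  have := norm_ivl_le hb (N l) (N (l + 1)) (∑ i ∈ F, a i • z i)
  rwa [ivl_sum_smul_eq hN hz F a hl, norm_smul, hz1, mul_one, Real.norm_eq_abs] at this

variable {δ : ℝ} {M : ℕ} (hnorm : IsNormalizedSeq b.basis) (hA : IsAsymptoticEll1 b.basis δ M)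
  (hb : IsBimonotone b)
include hnorm hA hb

/-- The averaging step: a long average of successive vectors is small on a class `𝒞` of sets if
each term is small on those sets in `𝒞` that start before the support of the term. -/
lemma exists_small_on_class {U : Submodule ℝ X} {s : ℕ → ℕ} (hs : StrictMono s)
    {𝒞 : Set (Finset ℕ)} {K : ℝ}
    (hK : ∀ G ∈ 𝒞, ∀ x : X, ∑ a ∈ G, ‖ivl b (s a) (s (a + 1)) x‖ ≤ K * ‖x‖)
    (hstep : ∀ N, ∀ η : ℝ, 0 < η → ∃ x ∈ U, ‖x‖ = 1 ∧ (∃ N', ivl b (s N) N' x = x) ∧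
      ∀ G ∈ 𝒞, ∀ a₀ ∈ G, (∀ a ∈ G, a₀ ≤ a) → a₀ < N →
        ∑ a ∈ G, ‖ivl b (s a) (s (a + 1)) x‖ ≤ η)
    (N : ℕ) {ε : ℝ} (hε : 0 < ε) :
    ∃ x ∈ U, ‖x‖ = 1 ∧ (∃ N', ivl b N N' x = x) ∧
      ∀ G ∈ 𝒞, ∑ a ∈ G, ‖ivl b (s a) (s (a + 1)) x‖ ≤ ε := by
  classical
  have hδ := hA.1
  obtain ⟨n, hn⟩ := exists_nat_gt ((|K| + 1) / (δ * ε))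
  have hn0 : (0 : ℝ) < n := lt_of_le_of_lt (by positivity) hn
  rw [div_lt_iff₀ (by positivity)] at hn
  obtain ⟨x, A, hA0, hAm, hx⟩ := exists_seq_of_step (α := X)
    (Q := fun _ a x a' => x ∈ U ∧ ‖x‖ = 1 ∧ ivl b (s a) (s a') x = x ∧
      ∀ G ∈ 𝒞, ∀ a₀ ∈ G, (∀ c ∈ G, a₀ ≤ c) → a₀ < a →
        ∑ c ∈ G, ‖ivl b (s c) (s (c + 1)) x‖ ≤ 1 / n) N fun _ a => by
    obtain ⟨x, hxU, hx1, ⟨N', hN'⟩, hx⟩ := hstep a (1 / n) (by positivity)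
    exact ⟨x, max N' (a + 1), by omega, hxU, hx1,
      ivl_mono_self b hN' le_rfl ((le_max_left _ _).trans hs.le_apply), hx⟩
  set y : X := ∑ i ∈ Finset.Ico n (2 * n), (1 : ℝ) • x i with hy
  have hsA : Monotone fun i => s (A i) := (hs.comp hAm).monotone
  have hylow : δ * n ≤ ‖y‖ := by
    have := mul_sum_norm_ivl_le_of_card hnorm hA hb (L := Finset.Ico n (2 * n))
      (c := fun i => s (A i)) (R := fun i => s (A (i + 1)))
      (fun i _ => hs (hAm (Nat.lt_add_one i))) (fun i _ j _ hij => hs.monotone (hAm.monotone hij))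
      (fun i hi => ?_) y
    · rw [Finset.sum_congr rfl fun i hi => by
        rw [hy, ivl_sum_smul_eq hsA (fun i => (hx i).2.2.1) _ (fun _ => 1) hi, one_smul,
          (hx i).2.1]] at this
      simpa [two_mul] using this
    · have h1 := (Finset.mem_Ico.1 hi).1
      have h2 : i ≤ s (A i) := (hs.comp hAm).le_apply
      simp only [Nat.card_Ico]
      omega
  have hypos : 0 < ‖y‖ := lt_of_lt_of_le (by positivity) hylow
  have hyG : ∀ G ∈ 𝒞, ∑ a ∈ G, ‖ivl b (s a) (s (a + 1)) y‖ ≤ |K| + 1 := by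
    intro G hG
    rcases G.eq_empty_or_nonempty with rfl | hGne
    · simp only [Finset.sum_empty]; positivity
    obtain ⟨a₀, ha₀, hmin⟩ := G.exists_min_image id hGne
    simp only [id] at hmin
    -- Only the term whose support contains the start of `G` is estimated by `K`.
    have hterm : ∀ i ∈ Finset.Ico n (2 * n), ∑ a ∈ G, ‖ivl b (s a) (s (a + 1)) (x i)‖ ≤
        1 / n + if A i ≤ a₀ ∧ a₀ < A (i + 1) then |K| else 0 := by
      intro i _
      obtain ⟨-, hx1, hxs, hxG⟩ := hx i
      have hn' : (0 : ℝ) ≤ 1 / n := by positivity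
      rcases lt_or_ge a₀ (A i) with h | h
      · rw [if_neg (by omega), add_zero]
        exact hxG G hG a₀ ha₀ hmin h
      · rcases lt_or_ge a₀ (A (i + 1)) with h' | h'
        · rw [if_pos ⟨h, h'⟩]
          have := hK G hG (x i)
          rw [hx1, mul_one] at this
          linarith [le_abs_self K]
        · rw [if_neg (by omega), add_zero, Finset.sum_eq_zero]
          · exact hn'
          · intro a ha
            rw [norm_eq_zero]
            refine ext_coord (b := b) fun c => ?_
            rw [coord_ivl, map_zero]
            split_ifs with hc
            · have := hs.monotone (h'.trans (hmin a ha))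
              exact (ivl_eq_self_iff b).1 hxs c (by omega)
            · rfl
    calc ∑ a ∈ G, ‖ivl b (s a) (s (a + 1)) y‖
        ≤ ∑ a ∈ G, ∑ i ∈ Finset.Ico n (2 * n), ‖ivl b (s a) (s (a + 1)) (x i)‖ := by
          refine Finset.sum_le_sum fun a _ => ?_
          rw [hy, map_sum]
          simp only [one_smul]
          exact norm_sum_le _ _
      _ = ∑ i ∈ Finset.Ico n (2 * n), ∑ a ∈ G, ‖ivl b (s a) (s (a + 1)) (x i)‖ :=
          Finset.sum_comm
      _ ≤ ∑ i ∈ Finset.Ico n (2 * n),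
            (1 / n + if A i ≤ a₀ ∧ a₀ < A (i + 1) then |K| else 0) := Finset.sum_le_sum hterm
      _ ≤ 1 + |K| := by
          rw [Finset.sum_add_distrib, ← Finset.sum_filter, Finset.sum_const, Finset.sum_const,
            nsmul_eq_mul, nsmul_eq_mul]
          refine add_le_add ?_ (mul_le_of_le_one_left (abs_nonneg K) ?_)
          · rw [Nat.card_Ico, two_mul, Nat.add_sub_cancel, mul_one_div_cancel hn0.ne']
          · exact_mod_cast Finset.card_le_one.2 fun i hi j hj => by
              have hi := (Finset.mem_filter.1 hi).2
              have hj := (Finset.mem_filter.1 hj).2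
              rcases lt_trichotomy i j with h | h | h
              · have := hAm.monotone (Nat.succ_le_of_lt h)
                simp only [Nat.succ_eq_add_one] at this
                omega
              · exact h
              · have := hAm.monotone (Nat.succ_le_of_lt h)
                simp only [Nat.succ_eq_add_one] at this
                omega
      _ = |K| + 1 := add_comm _ _
  refine ⟨‖y‖⁻¹ • y, U.smul_mem _ (U.sum_mem fun i _ => U.smul_mem _ (hx i).1), ?_,
    ⟨s (A (2 * n)), ?_⟩, fun G hG => ?_⟩
  · rw [norm_smul, norm_inv, norm_norm, inv_mul_cancel₀ hypos.ne']
  · rw [map_smul, hy, map_sum]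
    congr 1
    refine Finset.sum_congr rfl fun i hi => ?_
    rw [Finset.mem_Ico] at hi
    rw [map_smul, ivl_mono_self b (hx i).2.2.1]
    · calc N = A 0 := hA0.symm
        _ ≤ A i := hAm.monotone (Nat.zero_le _)
        _ ≤ s (A i) := hs.le_apply
    · exact hs.monotone (hAm.monotone hi.2)
  · simp only [map_smul, norm_smul, norm_inv, norm_norm]
    rw [← Finset.mul_sum, inv_mul_le_iff₀ hypos]
    calc _ ≤ |K| + 1 := hyG G hG
      _ ≤ n * (δ * ε) := hn.le
      _ = δ * n * ε := by ring
      _ ≤ ‖y‖ * ε := by gcongr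

/-- Every space with blocks contains normalized flat vectors of any order arbitrarily far out. -/
lemma exists_isFlat {U : Submodule ℝ X} (hU : HasBlocks b U) {s : ℕ → ℕ} (hs : StrictMono s)
    (ξ N : ℕ) {ε : ℝ} (hε : 0 < ε) :
    ∃ x ∈ U, ‖x‖ = 1 ∧ (∃ N', ivl b N N' x = x) ∧ IsFlat b s ξ ε x := by
  have hinj : Function.Injective fun a => s (a + 1) := fun l l' h =>
    Nat.succ_injective (hs.injective h)
  induction ξ generalizing N ε with
  | zero =>
    refine exists_small_on_class hnorm hA hb hs
      (𝒞 := {G | G.image (fun a => s (a + 1)) ∈ schreier 0})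
      (fun G hG x => sum_norm_ivl_le_of_mem_schreier hnorm hA hb hs hG x) (fun N η hη => ?_) N hε
    obtain ⟨x, hxU, hx0, N', hN'⟩ := hU (s N)
    refine ⟨‖x‖⁻¹ • x, U.smul_mem _ hxU, ?_, ⟨N', by rw [map_smul, hN']⟩, ?_⟩
    · rw [norm_smul, norm_inv, norm_norm, inv_mul_cancel₀ (norm_ne_zero_iff.2 hx0)]
    · intro G hG a₀ ha₀ _ hlt
      -- A set in `S_0` is a singleton, and its only interval lies before the support of `x`.
      have hG1 : ∀ a ∈ G, a = a₀ := by
        rcases hG with h | ⟨m, -, h⟩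
        · rw [Finset.image_eq_empty.1 h] at ha₀
          simp at ha₀
        · intro a ha
          apply hinj
          have h1 := Finset.mem_image_of_mem (fun a => s (a + 1)) ha
          have h2 := Finset.mem_image_of_mem (fun a => s (a + 1)) ha₀
          rw [h, Finset.mem_singleton] at h1 h2
          exact h1.trans h2.symm
      rw [Finset.sum_eq_zero]
      · exact hη.le
      · intro a ha
        rw [hG1 a ha, norm_eq_zero]
        refine ext_coord (b := b) fun c => ?_
        rw [coord_ivl, map_zero]
        split_ifs with hc
        · have := hs.monotone (Nat.succ_le_of_lt hlt)
          simp only [Nat.succ_eq_add_one] at this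
          rw [map_smul, (ivl_eq_self_iff b).1 hN' c (by omega), smul_zero]
        · rfl
  | succ ξ ih =>
    refine exists_small_on_class hnorm hA hb hs
      (𝒞 := {G | G.image (fun a => s (a + 1)) ∈ schreier (ξ + 1)})
      (fun G hG x => sum_norm_ivl_le_of_mem_schreier hnorm hA hb hs hG x) (fun N η hη => ?_) N hε
    obtain ⟨x, hxU, hx1, hxN, hflat⟩ := ih (s N) (ε := η / (s N + 1)) (by positivity)
    refine ⟨x, hxU, hx1, hxN, fun G hG a₀ ha₀ _ hlt => ?_⟩
    -- Such a set is the union of at most `s (a₀ + 1) ≤ s N` sets of order `ξ`.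
    obtain ⟨n, H, hH, -, hGH, hn⟩ := exists_biUnion_of_mem_schreier_succ hG
    have hnN : n ≤ s N := (hn _ (Finset.mem_image_of_mem _ ha₀)).trans (hs.monotone hlt)
    set G' : ℕ → Finset ℕ := fun j => G.filter fun a => s (a + 1) ∈ H j
    have hGG : ∀ a ∈ G, ∃ j ∈ Finset.range n, s (a + 1) ∈ H j := fun a ha => by
      have : s (a + 1) ∈ G.image fun a => s (a + 1) := Finset.mem_image_of_mem _ ha
      rwa [hGH, Finset.mem_biUnion] at this
    calc ∑ a ∈ G, ‖ivl b (s a) (s (a + 1)) x‖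
        ≤ ∑ j ∈ Finset.range n, ∑ a ∈ G' j, ‖ivl b (s a) (s (a + 1)) x‖ := by
          simp only [G', Finset.sum_filter]
          rw [Finset.sum_comm]
          refine Finset.sum_le_sum fun a ha => ?_
          obtain ⟨j, hj, haj⟩ := hGG a ha
          refine le_trans (le_of_eq (if_pos haj).symm) (Finset.single_le_sum
            (f := fun j => if s (a + 1) ∈ H j then ‖ivl b (s a) (s (a + 1)) x‖ else 0)
            (fun j _ => ?_) hj)
          split_ifs
          · exact norm_nonneg _
          · exact le_rfl
      _ ≤ ∑ j ∈ Finset.range n, η / (s N + 1) := by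
          refine Finset.sum_le_sum fun j hj => hflat _ (schreier_subset (hH j hj) fun c hc => ?_)
          obtain ⟨a, ha, rfl⟩ := Finset.mem_image.1 hc
          exact (Finset.mem_filter.1 ha).2
      _ = n * (η / (s N + 1)) := by rw [Finset.sum_const, nsmul_eq_mul, Finset.card_range]
      _ ≤ (s N + 1) * (η / (s N + 1)) := by
          gcongr
          exact_mod_cast hnN.trans (Nat.le_succ _)
      _ = η := by field_simp

/-- Every space with blocks contains a normalized block sequence all of whose normalized
combinations are flat. -/
lemma exists_seq_isFlat {U : Submodule ℝ X} (hU : HasBlocks b U) {s : ℕ → ℕ} (hs : StrictMono s)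
    (ξ : ℕ) {ε : ℝ} (hε : 0 < ε) :
    ∃ (z : ℕ → X) (A : ℕ → ℕ), StrictMono A ∧ (∀ i, z i ∈ U) ∧ (∀ i, ‖z i‖ = 1) ∧
      (∀ i, ivl b (s (A i)) (s (A (i + 1))) (z i) = z i) ∧
      ∀ (F : Finset ℕ) (a : ℕ → ℝ), ‖∑ i ∈ F, a i • z i‖ = 1 →
        IsFlat b s ξ ε (∑ i ∈ F, a i • z i) := by
  obtain ⟨z, A, -, hAm, hz⟩ := exists_seq_of_step (α := X)
    (Q := fun i a x a' => x ∈ U ∧ ‖x‖ = 1 ∧ ivl b (s a) (s a') x = x ∧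
      IsFlat b s ξ (ε / 2 / 2 ^ i) x) 0 fun i a => by
    obtain ⟨x, hxU, hx1, ⟨N', hN'⟩, hx⟩ :=
      exists_isFlat hnorm hA hb hU hs ξ (s a) (ε := ε / 2 / 2 ^ i) (by positivity)
    exact ⟨x, max N' (a + 1), by omega, hxU, hx1,
      ivl_mono_self b hN' le_rfl ((le_max_left _ _).trans hs.le_apply), hx⟩
  refine ⟨z, A, hAm, fun i => (hz i).1, fun i => (hz i).2.1, fun i => (hz i).2.2.1,
    fun F a hF G hG => ?_⟩
  have ha : ∀ i ∈ F, |a i| ≤ 1 := fun i hi => hF ▸ abs_coeff_le_norm hb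
    (N := fun i => s (A i)) (hs.comp hAm).monotone (fun i => (hz i).2.2.1) (fun i => (hz i).2.1)
    F a hi
  calc ∑ c ∈ G, ‖ivl b (s c) (s (c + 1)) (∑ i ∈ F, a i • z i)‖
      ≤ ∑ c ∈ G, ∑ i ∈ F, ‖ivl b (s c) (s (c + 1)) (z i)‖ := by
        refine Finset.sum_le_sum fun c _ => ?_
        rw [map_sum]
        refine (norm_sum_le _ _).trans (Finset.sum_le_sum fun i hi => ?_)
        rw [map_smul, norm_smul, Real.norm_eq_abs]
        exact mul_le_of_le_one_left (norm_nonneg _) (ha i hi)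
    _ = ∑ i ∈ F, ∑ c ∈ G, ‖ivl b (s c) (s (c + 1)) (z i)‖ := Finset.sum_comm
    _ ≤ ∑ i ∈ F, ε / 2 / 2 ^ i := Finset.sum_le_sum fun i _ => (hz i).2.2.2 G hG
    _ ≤ ∑' i : ℕ, ε / 2 / 2 ^ i :=
        (summable_geometric_two' ε).sum_le_tsum F fun i _ => by positivity
    _ = ε := tsum_geometric_two' ε

end Flat

/-! ### Cutting vectors at the points of an admissible family -/

section BlockSequences

variable {X : Type*} [NormedAddCommGroup X] [NormedSpace ℝ X]

/-- If `τ(u, ε) < p`, then the `ε`-`ℓ₁^p` estimate fails for some normalized block basis of `u`. -/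
lemma exists_norm_sum_lt_of_tau_lt {u : ℕ → X} {ε : ℝ} {p : ℕ} (hε : 0 < ε)
    (h : tau u ε < (p : ℕ∞)) :
    ∃ v : ℕ → X, IsBlockBasis u v ∧ IsNormalizedSeq v ∧ ∃ F ∈ schreier p, ∃ a : ℕ → ℝ,
      ‖∑ i ∈ F, a i • v (i - 1)‖ < ε * ∑ i ∈ F, |a i| := by
  by_contra! hcon
  refine absurd h (not_lt.2 (le_sSup ⟨p, rfl, fun v hv hv1 => ⟨id, strictMono_id, hε, hv1, ?_⟩⟩))
  exact fun F hF a => hcon v hv hv1 F hF a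

/-- A block basis of successive vectors is again successive, with supports in intervals whose
end points are taken from the given ones. -/
lemma exists_intervals_of_isBlockBasis {b : SchauderBasis ℝ X} {z : ℕ → X} {N : ℕ → ℕ}
    (hN : StrictMono N) (hz : ∀ i, ivl b (N i) (N (i + 1)) (z i) = z i) {v : ℕ → X}
    (hv : IsBlockBasis z v) :
    ∃ m : ℕ → ℕ, StrictMono m ∧ ∀ i, ivl b (N (m i)) (N (m (i + 1))) (v i) = v i ∧
      ∃ (F : Finset ℕ) (a : ℕ → ℝ), v i = ∑ l ∈ F, a l • z l := by
  obtain ⟨F, hF, hlt, a, ha⟩ := hv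
  refine ⟨fun i => (F i).min' (hF i), strictMono_nat_of_lt_succ fun i =>
    hlt i (i + 1) (Nat.lt_add_one i) _ (Finset.min'_mem _ _) _ (Finset.min'_mem _ _),
    fun i => ⟨?_, F i, a, (ha i).2⟩⟩
  conv_rhs => rw [(ha i).2]
  rw [(ha i).2, map_sum]
  refine Finset.sum_congr rfl fun l hl => ?_
  rw [map_smul, ivl_mono_self b (hz l)]
  · exact hN.monotone (Finset.min'_le _ _ hl)
  · exact hN.monotone (hlt i (i + 1) (Nat.lt_add_one i) l hl _ (Finset.min'_mem _ _))

end BlockSequences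

section Admissible

variable {X : Type*} [NormedAddCommGroup X] [NormedSpace ℝ X] {b : SchauderBasis ℝ X}

/-- An admissible sum of functionals from the unit ball is dominated by the norms of the pieces of
the vector cut at the minima of the supports. -/
lemma exists_cuts_of_isAdmissible {ξ k : ℕ} {g : Fin k → StrongDual ℝ X}
    (hg : ∀ i, ‖g i‖ ≤ 1) (h : IsAdmissible b ξ g) :
    ∃ t : ℕ → ℕ, StrictMono t ∧ (Finset.range k).image (fun l => t l + 1) ∈ schreier ξ ∧
      ∀ x, ∑ i, g i x ≤ ∑ l ∈ Finset.range k, ‖ivl b (t l) (t (l + 1)) x‖ := by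
  obtain ⟨F, hF, ⟨-, hlt, a, ha⟩, hS⟩ := h
  obtain ⟨N, hN⟩ : ∃ N, ∀ i, ∀ l ∈ F i, l < N := by
    refine ⟨(Finset.univ.biUnion F).sup id + 1, fun i l hl => Nat.lt_succ_of_le ?_⟩
    exact Finset.le_sup (f := id) (Finset.mem_biUnion.2 ⟨i, Finset.mem_univ _, hl⟩)
  let t : ℕ → ℕ := fun l => if h : l < k then (F ⟨l, h⟩).min' (hF _) else N + l
  have htk : ∀ i : Fin k, t i = (F i).min' (hF i) := fun i => by simp [t]
  have hFt : ∀ i : Fin k, ∀ c ∈ F i, t i ≤ c ∧ c < t (i + 1) := by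
    intro i c hc
    refine ⟨(htk i).trans_le (Finset.min'_le _ _ hc), ?_⟩
    by_cases h : (i : ℕ) + 1 < k
    · simp only [t, dif_pos h]
      exact hlt i ⟨i + 1, h⟩ (Fin.lt_def.2 (Nat.lt_add_one _)) c hc _ (Finset.min'_mem _ _)
    · simp only [t, dif_neg h]
      have := hN i c hc
      omega
  refine ⟨t, strictMono_nat_of_lt_succ fun l => ?_, ?_, fun x => ?_⟩
  · by_cases h : l < k
    · have := hFt ⟨l, h⟩ _ (Finset.min'_mem _ (hF _))
      exact this.1.trans_lt this.2
    · simp only [t, dif_neg h, dif_neg (show ¬ l + 1 < k by omega)]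
      omega
  · convert hS using 1
    ext s
    simp only [Finset.mem_image, Finset.mem_range, Finset.mem_univ, true_and]
    constructor
    · rintro ⟨l, hl, rfl⟩
      exact ⟨⟨l, hl⟩, by rw [← htk]⟩
    · rintro ⟨i, rfl⟩
      exact ⟨i, i.2, by rw [← htk]⟩
  · rw [← Fin.sum_univ_eq_sum_range fun l => ‖ivl b (t l) (t (l + 1)) x‖]
    refine Finset.sum_le_sum fun i _ => ?_
    have h1 : g i x = g i (ivl b (t i) (t (i + 1)) x) := by
      rw [(ha i).2]
      simp only [sum_apply, smul_apply]
      refine Finset.sum_congr rfl fun c hc => ?_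
      rw [coord_ivl, if_pos (hFt i c hc)]
    rw [h1]
    calc _ ≤ ‖g i (ivl b (t i) (t (i + 1)) x)‖ := le_abs_self _
      _ ≤ 1 * ‖ivl b (t i) (t (i + 1)) x‖ := ContinuousLinearMap.le_of_opNorm_le _ (hg i) _
      _ = _ := one_mul _

end Admissible

section Cutting

variable {X : Type*} [NormedAddCommGroup X] [NormedSpace ℝ X] {b : SchauderBasis ℝ X}

lemma exists_le_lt_succ {s : ℕ → ℕ} (hs : StrictMono s) {c : ℕ} (h : s 0 ≤ c) :
    ∃ a, s a ≤ c ∧ c < s (a + 1) := by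
  refine ⟨Nat.findGreatest (fun a => s a ≤ c) c, Nat.findGreatest_spec (P := fun a => s a ≤ c)
    (Nat.zero_le c) h, ?_⟩
  by_contra hcon
  rw [not_lt] at hcon
  exact Nat.findGreatest_is_greatest (Nat.lt_add_one _) (hs.le_apply.trans hcon) hcon

variable {δ : ℝ} {M : ℕ} (hnorm : IsNormalizedSeq b.basis) (hA : IsAsymptoticEll1 b.basis δ M)
  (hb : IsBimonotone b)
include hnorm hA hb

/-- A flat vector is, up to a small error, a vector none of whose pieces over the intervals
`[s a, s (a + 1))` is cut by the points `t l`; these can then be moved up to the points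
`s (α l)`. -/
lemma exists_uncut {s : ℕ → ℕ} (hs : StrictMono s) {ξ B B' : ℕ} (hBB : B ≤ B') {ε : ℝ} {v : X}
    (hv : ivl b (s B) (s B') v = v) (hflat : IsFlat b s ξ ε v) {t : ℕ → ℕ} (ht : StrictMono t)
    {r : ℕ} (htS : (Finset.range r).image (fun l => t l + 1) ∈ schreier ξ) :
    ∃ (w : X) (α : ℕ → ℕ), Monotone α ∧ ‖w - v‖ ≤ ε ∧
      (∀ c, b.coord c v = 0 → b.coord c w = 0) ∧ (∀ l, B ≤ α l ∧ α l ≤ B') ∧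
      (∀ l, α l < α (l + 1) → t l ≤ s (α l)) ∧
      ∑ l ∈ Finset.range r, ‖ivl b (t l) (t (l + 1)) v‖ ≤
        ∑ l ∈ Finset.range r, ‖ivl b (s (α l)) (s (α (l + 1))) w‖ + (1 + δ⁻¹) ^ ξ * ε := by
  classical
  have hδ := hA.1
  -- The indices of the intervals that are cut by some `t l`; the corresponding pieces of `v` are
  -- removed.
  set G := (Finset.range B').filter fun a => ∃ l ∈ Finset.range r, s a < t l ∧ t l < s (a + 1)
    with hG
  have hGS : G.image (fun a => s (a + 1)) ∈ schreier ξ := by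
    have hex : ∀ a, ∃ l, a ∈ G → l ∈ Finset.range r ∧ s a < t l ∧ t l < s (a + 1) := fun a => by
      by_cases ha : a ∈ G
      · obtain ⟨l, hl⟩ := (Finset.mem_filter.1 ha).2
        exact ⟨l, fun _ => hl⟩
      · exact ⟨0, fun h => absurd h ha⟩
    choose l hl using hex
    refine image_mem_schreier_of_le (f := fun a => t (l a) + 1) ?_ ?_ ?_ (schreier_subset htS ?_)
    · intro a ha a' ha' h
      have h1 := hs.monotone (Nat.succ_le_of_lt h)
      have h2 := (hl a ha).2.2
      have h3 := (hl a' ha').2.1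
      simp only [Nat.succ_eq_add_one] at h1
      simp only
      omega
    · exact fun a _ a' _ h => hs (Nat.succ_lt_succ h)
    · exact fun a ha => (hl a ha).2.2
    · intro c hc
      obtain ⟨a, ha, rfl⟩ := Finset.mem_image.1 hc
      exact Finset.mem_image_of_mem (fun l => t l + 1) (hl a ha).1
  set e : X := ∑ a ∈ G, ivl b (s a) (s (a + 1)) v with he
  have hnorm_e : ‖e‖ ≤ ε := (norm_sum_le _ _).trans (hflat G hGS)
  have hcoord_e : ∀ c, b.coord c v = 0 → b.coord c e = 0 := fun c hc => by
    simp only [he, map_sum, coord_ivl, hc, ite_self, Finset.sum_const_zero]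
  have hcut : ∀ c, b.coord c (v - e) ≠ 0 → ∀ a, s a ≤ c → c < s (a + 1) → a ∉ G := by
    intro c hc a hac hca haG
    apply hc
    rw [map_sub, he, map_sum, Finset.sum_eq_single a]
    · rw [coord_ivl, if_pos ⟨hac, hca⟩, sub_self]
    · intro a' _ hne
      rw [coord_ivl, if_neg]
      rintro ⟨h1, h2⟩
      rcases lt_or_gt_of_ne hne with h | h
      · have := hs.monotone (Nat.succ_le_of_lt h)
        simp only [Nat.succ_eq_add_one] at this
        omega
      · have := hs.monotone (Nat.succ_le_of_lt h)
        simp only [Nat.succ_eq_add_one] at this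
        omega
    · exact fun h => absurd haG h
  -- `β l` is the first index with `t l ≤ s (β l)`, and `α l` its truncation to `[B, B']`.
  have hub : ∀ l, ∃ a, t l ≤ s a := fun l => ⟨t l, hs.le_apply⟩
  set β : ℕ → ℕ := fun l => Nat.find (hub l) with hβ
  have hβs : ∀ l, t l ≤ s (β l) := fun l => Nat.find_spec (hub l)
  have hβmin : ∀ l a, t l ≤ s a → β l ≤ a := fun l a h => Nat.find_min' (hub l) h
  have hβm : Monotone β := fun l l' h => hβmin l _ ((ht.monotone h).trans (hβs l'))
  refine ⟨v - e, fun l => max B (min B' (β l)), fun l l' h => max_le_max le_rfl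
    (min_le_min le_rfl (hβm h)), ?_, fun c hc => ?_, fun l => ⟨le_max_left _ _, ?_⟩,
    fun l hl => ?_, ?_⟩
  · rwa [sub_sub_cancel_left, norm_neg]
  · rw [map_sub, hc, hcoord_e c hc, sub_zero]
  · exact max_le hBB (min_le_left _ _)
  · refine (hβs l).trans (hs.monotone ?_)
    have hl' : max B (min B' (β l)) < max B (min B' (β (l + 1))) := hl
    change β l ≤ max B (min B' (β l))
    clear hl
    omega
  · have hpiece : ∀ l ∈ Finset.range r, ‖ivl b (t l) (t (l + 1)) v‖ ≤
        ‖ivl b (s (max B (min B' (β l)))) (s (max B (min B' (β (l + 1))))) (v - e)‖ +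
          ‖ivl b (t l) (t (l + 1)) e‖ := by
      intro l hl
      have h1 : ivl b (t l) (t (l + 1)) (v - e) = ivl b (t l) (t (l + 1))
          (ivl b (s (max B (min B' (β l)))) (s (max B (min B' (β (l + 1))))) (v - e)) := by
        refine ext_coord (b := b) fun c => ?_
        rw [coord_ivl, coord_ivl, coord_ivl]
        by_cases hc : t l ≤ c ∧ c < t (l + 1)
        · rw [if_pos hc, if_pos hc]
          by_cases hc0 : b.coord c (v - e) = 0
          · rw [hc0, ite_self]
          have hcv : b.coord c v ≠ 0 := fun h => hc0 (by rw [map_sub, h, hcoord_e c h, sub_zero])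
          have hcB : s B ≤ c ∧ c < s B' := by
            by_contra h
            exact hcv ((ivl_eq_self_iff b).1 hv c (by omega))
          obtain ⟨a, hac, hca⟩ := exists_le_lt_succ hs ((hs.monotone (Nat.zero_le B)).trans hcB.1)
          have haB : a < B' := hs.lt_iff_lt.1 (hac.trans_lt hcB.2)
          have hta : t l ≤ s a := by
            by_contra h
            exact hcut c hc0 a hac hca (Finset.mem_filter.2 ⟨Finset.mem_range.2 haB, l, hl,
              not_le.1 h, hc.1.trans_lt hca⟩)
          have hBa : B ≤ a := Nat.lt_succ_iff.1 (hs.lt_iff_lt.1 (hcB.1.trans_lt hca))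
          rw [if_pos]
          refine ⟨(hs.monotone (max_le hBa ((min_le_right _ _).trans (hβmin l a hta)))).trans hac,
            ?_⟩
          refine lt_of_lt_of_le ?_ (hs.monotone (le_max_right _ _))
          rcases min_choice B' (β (l + 1)) with h | h
          · rw [h]; exact hcB.2
          · rw [h]; exact hc.2.trans_le (hβs _)
        · rw [if_neg hc, if_neg hc]
      have h2 : v = (v - e) + e := (sub_add_cancel v e).symm
      conv_lhs => rw [h2, map_add, h1]
      exact (norm_add_le _ _).trans (add_le_add (norm_ivl_le hb _ _ _) le_rfl)
    refine (Finset.sum_le_sum hpiece).trans ?_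
    rw [Finset.sum_add_distrib]
    refine add_le_add le_rfl ?_
    have htS' : (Finset.range r).image (fun l => t (l + 1)) ∈ schreier ξ :=
      image_mem_schreier_of_le (f := fun l => t l + 1) (fun l _ l' _ h => Nat.succ_lt_succ (ht h))
        (fun l _ l' _ h => ht (Nat.succ_lt_succ h)) (fun l _ => ht (Nat.lt_add_one l)) htS
    refine (sum_norm_ivl_le_of_mem_schreier hnorm hA hb ht htS' e).trans ?_
    gcongr

/-- Lower `ℓ₁` estimate for the pieces of successive vectors `w i`, `i ∈ F`, cut at points
`s (α i l)`, where the vectors vanish on the first half `[s a, 2 * s a + 2)` of every interval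
`[s a, s (a + 1))`. The coordinates in these halves are used as cut points too; they push the
pieces so far to the right that the positions dominate the points `t i l`. -/
lemma mul_sum_sum_norm_ivl_le {s : ℕ → ℕ} (hs : StrictMono s)
    (hs2 : ∀ a, 2 * s a + 2 < s (a + 1)) {ξ ζ : ℕ} (hM : ξ + ζ ≤ M) {F : Finset ℕ}
    (hF : F ∈ schreier ζ) {B B' : ℕ → ℕ} (hB : ∀ i ∈ F, i ≤ B i + 1)
    (hBB : ∀ i ∈ F, ∀ j ∈ F, i < j → B' i ≤ B j) {w : ℕ → X}
    (hw : ∀ i ∈ F, ivl b (s (B i)) (s (B' i)) (w i) = w i)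
    (hsp : ∀ i ∈ F, ∀ a c, s a ≤ c → c < 2 * s a + 2 → b.coord c (w i) = 0)
    {α : ℕ → ℕ → ℕ} (hα : ∀ i ∈ F, Monotone (α i))
    (hαB : ∀ i ∈ F, ∀ l, B i ≤ α i l ∧ α i l ≤ B' i) {r : ℕ → ℕ} {t : ℕ → ℕ → ℕ}
    (ht : ∀ i ∈ F, StrictMono (t i))
    (htS : ∀ i ∈ F, (Finset.range (r i)).image (fun l => t i l + 1) ∈ schreier ξ)
    (htα : ∀ i ∈ F, ∀ l, α i l < α i (l + 1) → t i l ≤ s (α i l)) :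
    δ * ∑ i ∈ F, ∑ l ∈ Finset.range (r i), ‖ivl b (s (α i l)) (s (α i (l + 1))) (w i)‖ ≤
      ‖∑ i ∈ F, w i‖ := by
  classical
  -- Pairs with `α i l = α i (l + 1)` give empty pieces and are left out.
  set Λ : Finset (Σ _ : ℕ, ℕ) :=
    F.sigma fun i => (Finset.range (r i)).filter fun l => α i l < α i (l + 1) with hΛ
  have hmem : ∀ q ∈ Λ, q.1 ∈ F ∧ q.2 < r q.1 ∧ α q.1 q.2 < α q.1 (q.2 + 1) := fun q hq => by
    simpa [hΛ] using hq
  have hord1 : ∀ q ∈ Λ, ∀ q' ∈ Λ, q.1 < q'.1 → α q.1 (q.2 + 1) ≤ α q'.1 q'.2 :=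
    fun q hq q' hq' h => ((hαB _ (hmem q hq).1 _).2.trans
      (hBB _ (hmem q hq).1 _ (hmem q' hq').1 h)).trans (hαB _ (hmem q' hq').1 _).1
  have hord2 : ∀ i ∈ F, ∀ l l', l < l' → α i (l + 1) ≤ α i l' := fun i hi l l' h => hα i hi h
  have hord : ∀ q ∈ Λ, ∀ q' ∈ Λ, q = q' ∨ α q.1 (q.2 + 1) ≤ α q'.1 q'.2 ∨
      α q'.1 (q'.2 + 1) ≤ α q.1 q.2 := by
    intro q hq q' hq'
    rcases lt_trichotomy q.1 q'.1 with h | h | h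
    · exact Or.inr (Or.inl (hord1 q hq q' hq' h))
    · obtain ⟨i, l⟩ := q
      obtain ⟨i', l'⟩ := q'
      obtain rfl : i = i' := h
      rcases lt_trichotomy l l' with h' | rfl | h'
      · exact Or.inr (Or.inl (hord2 i (hmem _ hq).1 _ _ h'))
      · exact Or.inl rfl
      · exact Or.inr (Or.inr (hord2 i (hmem _ hq).1 _ _ h'))
    · exact Or.inr (Or.inr (hord1 q' hq' q hq h))
  set c : (Σ _ : ℕ, ℕ) → ℕ := fun q => 2 * s (α q.1 q.2) + 2 with hc
  set R : (Σ _ : ℕ, ℕ) → ℕ := fun q => s (α q.1 (q.2 + 1)) with hR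
  set N := F.sup fun i => s (B' i) with hN
  have hRN : ∀ q ∈ Λ, R q ≤ N := fun q hq => (hs.monotone (hαB _ (hmem q hq).1 _).2).trans
    (Finset.le_sup (f := fun i => s (B' i)) (hmem q hq).1)
  have hcR : ∀ q ∈ Λ, c q < R q := fun q hq =>
    (hs2 _).trans_le (hs.monotone (hmem q hq).2.2)
  have hRc : ∀ q q' : (Σ _ : ℕ, ℕ), α q.1 (q.2 + 1) ≤ α q'.1 q'.2 → R q ≤ s (α q'.1 q'.2) :=
    fun q q' h => hs.monotone h
  let T : ℕ → Prop := fun τ => (∃ q ∈ Λ, s (α q.1 q.2) ≤ τ ∧ τ ≤ c q) ∨ N ≤ τ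
  have hsc : ∀ q, s (α q.1 q.2) ≤ c q := fun q => by simp only [hc]; omega
  have hcT : ∀ q ∈ Λ, T (c q) := fun q hq => Or.inl ⟨q, hq, hsc q, le_rfl⟩
  -- The `s a + 2` cut points of `[s a, 2 * s a + 2)` lie below `c q`, where `a = α q.1 q.2`.
  have hpos : ∀ q ∈ Λ, s (α q.1 q.2) + 2 ≤ Nat.count T (c q) := fun q hq => by
    have h1 : c q = s (α q.1 q.2) + (s (α q.1 q.2) + 2) := by simp only [hc]; omega
    have h2 : Nat.count (fun k => T (s (α q.1 q.2) + k)) (s (α q.1 q.2) + 2) =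
        s (α q.1 q.2) + 2 :=
      Nat.count_iff_forall.2 fun k hk => Or.inl ⟨q, hq, Nat.le_add_right _ _, by omega⟩
    rw [h1, Nat.count_add, h2]
    exact Nat.le_add_left _ _
  have hclt : ∀ q ∈ Λ, ∀ q' ∈ Λ, α q.1 (q.2 + 1) ≤ α q'.1 q'.2 →
      Nat.count T (c q) < Nat.count T (c q') := fun q hq q' hq' h =>
    Nat.count_strict_mono (hcT q hq) (((hcR q hq).trans_le (hRc q q' h)).trans_le (hsc q'))
  have hsum : ∀ x, b.coord x (∑ i ∈ F, w i) ≠ 0 → ∃ i ∈ F, b.coord x (w i) ≠ 0 := fun x hx => by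
    rw [map_sum] at hx
    exact Finset.exists_ne_zero_of_sum_ne_zero hx
  have key : δ * ∑ q ∈ Λ, ‖ivl b (c q) (R q) (∑ i ∈ F, w i)‖ ≤ ‖∑ i ∈ F, w i‖ := by
    refine mul_sum_norm_ivl_le_of_cuts hnorm hA hb (T := T) (N := N) (fun τ hτ => Or.inr hτ) ?_
      hcT (fun q hq => (hcR q hq).trans_le (hRN q hq)) ?_ ?_ ?_
    · intro q hq q' hq' h
      rcases hord q hq q' hq' with h' | h' | h'
      · exact h'
      · exact absurd (congrArg (Nat.count T) h) (hclt q hq q' hq' h').ne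
      · exact absurd (congrArg (Nat.count T) h) (hclt q' hq' q hq h').ne'
    · rintro q hq τ (⟨q', hq', h1, h2⟩ | h) hτ
      · rcases hord q hq q' hq' with rfl | h' | h'
        · omega
        · exact (hRc q q' h').trans h1
        · have := hRc q' q h'
          have := hcR q' hq'
          have := hsc q
          omega
      · exact (hRN q hq).trans h
    · have himg : Λ.image (fun q => Nat.count T (c q) + 1) = F.biUnion fun i =>
          ((Finset.range (r i)).filter fun l => α i l < α i (l + 1)).image
            fun l => Nat.count T (c ⟨i, l⟩) + 1 := by
        ext x
        simp only [hΛ, Finset.mem_image, Finset.mem_biUnion, Finset.mem_sigma]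
        constructor
        · rintro ⟨⟨i, l⟩, ⟨hi, hl⟩, rfl⟩
          exact ⟨i, hi, l, hl, rfl⟩
        · rintro ⟨i, hi, l, hl, rfl⟩
          exact ⟨⟨i, l⟩, ⟨hi, hl⟩, rfl⟩
      have hΛmem : ∀ i ∈ F, ∀ l ∈ (Finset.range (r i)).filter (fun l => α i l < α i (l + 1)),
          (⟨i, l⟩ : Σ _ : ℕ, ℕ) ∈ Λ := fun i hi l hl => Finset.mem_sigma.2 ⟨hi, hl⟩
      rw [himg]
      refine schreier_le hM (biUnion_mem_schreier_add hF (fun i hi => ?_) (fun i hi x hx => ?_)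
        fun i hi j hj hij x hx y hy => ?_)
      · refine image_mem_schreier_of_le (f := fun l => t i l + 1)
          (fun l _ l' _ h => Nat.succ_lt_succ (ht i hi h)) (fun l hl l' hl' h => ?_)
          (fun l hl => ?_) (schreier_subset (htS i hi)
            (Finset.image_subset_image (Finset.filter_subset _ _)))
        · exact Nat.succ_lt_succ (hclt _ (hΛmem i hi l hl) _ (hΛmem i hi l' hl')
            (hord2 i hi l l' h))
        · have h1 := hpos _ (hΛmem i hi l hl)
          have h2 := htα i hi l (Finset.mem_filter.1 hl).2
          simp only at h1 ⊢
          omega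
      · obtain ⟨l, hl, rfl⟩ := Finset.mem_image.1 hx
        have h1 := hpos _ (hΛmem i hi l hl)
        have h2 := hB i hi
        have h3 := (hαB i hi l).1
        have h4 : α i l ≤ s (α i l) := hs.le_apply
        simp only at h1 ⊢
        omega
      · obtain ⟨l, hl, rfl⟩ := Finset.mem_image.1 hx
        obtain ⟨l', hl', rfl⟩ := Finset.mem_image.1 hy
        exact Nat.succ_lt_succ (hclt _ (hΛmem i hi l hl) _ (hΛmem j hj l' hl')
          (hord1 _ (hΛmem i hi l hl) _ (hΛmem j hj l' hl') hij))
    · intro x hx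
      obtain ⟨i, hi, hxi⟩ := hsum x hx
      have hxB : s (B i) ≤ x ∧ x < s (B' i) := by
        by_contra h
        exact hxi ((ivl_eq_self_iff b).1 (hw i hi) x (by omega))
      obtain ⟨a, hax, hxa⟩ := exists_le_lt_succ hs ((hs.monotone (Nat.zero_le _)).trans hxB.1)
      have hax2 : 2 * s a + 2 ≤ x := by
        by_contra h
        exact hxi (hsp i hi a x hax (not_le.1 h))
      rcases (Λ.filter fun q => c q ≤ x).eq_empty_or_nonempty with h0 | h0
      · refine Or.inl fun q hq => ?_
        by_contra h
        have : q ∈ Λ.filter fun q => c q ≤ x := Finset.mem_filter.2 ⟨hq, not_lt.1 h⟩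
        rw [h0] at this
        simp at this
      · obtain ⟨q, hq, hmax⟩ := Finset.exists_max_image _ c h0
        rw [Finset.mem_filter] at hq
        by_cases hNx : N ≤ x
        · exact Or.inr (Or.inl hNx)
        refine Or.inr (Or.inr ⟨q, hq.1, hq.2, ?_⟩)
        rintro τ (⟨q', hq', h1, h2⟩ | h) hτ
        · by_contra hcon
          have haq : α q'.1 q'.2 ≤ a := Nat.lt_succ_iff.1 (hs.lt_iff_lt.1
            ((h1.trans (not_lt.1 hcon)).trans_lt hxa))
          have h3 : c q' ≤ x := by
            have := hs.monotone haq
            simp only [hc]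
            omega
          have := hmax q' (Finset.mem_filter.2 ⟨hq', h3⟩)
          omega
        · omega
  have hpiece : ∀ q ∈ Λ, ivl b (c q) (R q) (∑ i ∈ F, w i) =
      ivl b (s (α q.1 q.2)) (s (α q.1 (q.2 + 1))) (w q.1) := by
    intro q hq
    obtain ⟨hqF, -, hqα⟩ := hmem q hq
    refine ext_coord (b := b) fun x => ?_
    rw [coord_ivl, coord_ivl]
    by_cases h : s (α q.1 q.2) ≤ x ∧ x < R q
    · have h0 : b.coord x (∑ i ∈ F, w i) = b.coord x (w q.1) := by
        rw [map_sum]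
        refine Finset.sum_eq_single q.1 (fun i hi hne => ?_) fun h => absurd hqF h
        refine (ivl_eq_self_iff b).1 (hw i hi) x ?_
        have h1 := hs.monotone (hαB _ hqF q.2).1
        have h2 : R q ≤ s (B' q.1) := hs.monotone (hαB _ hqF (q.2 + 1)).2
        rcases lt_or_gt_of_ne hne with h' | h'
        · have := hs.monotone (hBB i hi _ hqF h')
          omega
        · have := hs.monotone (hBB _ hqF i hi h')
          omega
      rw [h0, if_pos h]
      by_cases h' : c q ≤ x
      · rw [if_pos ⟨h', h.2⟩]
      · rw [if_neg (by omega), hsp _ hqF _ x h.1 (not_le.1 h')]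
    · have := hsc q
      rw [if_neg h, if_neg (by omega)]
  have hsigma : ∑ i ∈ F, ∑ l ∈ Finset.range (r i),
      ‖ivl b (s (α i l)) (s (α i (l + 1))) (w i)‖ =
      ∑ q ∈ Λ, ‖ivl b (s (α q.1 q.2)) (s (α q.1 (q.2 + 1))) (w q.1)‖ := by
    rw [hΛ, Finset.sum_sigma]
    refine Finset.sum_congr rfl fun i hi => (Finset.sum_filter_of_ne fun l _ hne => ?_).symm
    by_contra h
    have h1 : α i l = α i (l + 1) := le_antisymm (hα i hi (Nat.le_succ l)) (not_lt.1 h)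
    apply hne
    rw [← h1, ivl_apply, Finset.Ico_self, Finset.sum_empty, norm_zero]
  rw [hsigma, ← Finset.sum_congr rfl fun q hq => congrArg norm (hpiece q hq)]
  exact key

end Cutting

/-! ### Vectors with small and with large distorting norm -/

section GoodVector

variable {X : Type*} [NormedAddCommGroup X] [NormedSpace ℝ X] {b : SchauderBasis ℝ X}

/-- Every space with blocks contains one whose vectors vanish on the first half of every interval
`[s a, s (a + 1))`, for a suitable `s`. -/
lemma exists_sparse_subspace {U : Submodule ℝ X} (hU : HasBlocks b U) :
    ∃ (s : ℕ → ℕ) (W : Submodule ℝ X), StrictMono s ∧ (∀ a, 2 * s a + 2 < s (a + 1)) ∧ W ≤ U ∧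
      HasBlocks b W ∧ ∀ x ∈ W, ∀ a c, s a ≤ c → c < 2 * s a + 2 → b.coord c x = 0 := by
  obtain ⟨w, s, -, hs, hw⟩ := exists_seq_of_step (α := X)
    (Q := fun _ a x a' => x ∈ U ∧ x ≠ 0 ∧ ivl b (2 * a + 2) a' x = x ∧ 2 * a + 2 < a') 0
    fun _ a => by
      obtain ⟨x, hxU, hx0, N', hN'⟩ := hU (2 * a + 2)
      exact ⟨x, max N' (2 * a + 3), by omega, hxU, hx0,
        ivl_mono_self b hN' le_rfl (le_max_left _ _), by omega⟩
  refine ⟨s, Submodule.span ℝ (Set.range w), hs, fun a => (hw a).2.2.2, ?_, fun N => ?_, ?_⟩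
  · rw [Submodule.span_le]
    rintro _ ⟨i, rfl⟩
    exact (hw i).1
  · refine ⟨w N, Submodule.subset_span ⟨N, rfl⟩, (hw N).2.1, s (N + 1),
      ivl_mono_self b (hw N).2.2.1 ?_ le_rfl⟩
    have : N ≤ s N := hs.le_apply
    omega
  · intro x hx a c hac hca
    induction hx using Submodule.span_induction with
    | mem x hx =>
      obtain ⟨i, rfl⟩ := hx
      refine (ivl_eq_self_iff b).1 (hw i).2.2.1 c ?_
      rcases lt_trichotomy i a with h | rfl | h
      · have := hs.monotone (Nat.succ_le_of_lt h)
        simp only [Nat.succ_eq_add_one] at this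
        omega
      · omega
      · have := hs.monotone (Nat.succ_le_of_lt h)
        simp only [Nat.succ_eq_add_one] at this
        have := (hw a).2.2.2
        omega
    | zero => rw [map_zero]
    | add x y _ _ hx hy => rw [map_add, hx, hy, add_zero]
    | smul r x _ hx => rw [map_smul, hx, smul_zero]

variable {δ : ℝ} {M : ℕ} (hnorm : IsNormalizedSeq b.basis) (hA : IsAsymptoticEll1 b.basis δ M)
  (hb : IsBimonotone b)
include hnorm hA hb

/-- Every space with blocks contains a normalized vector whose pieces over `S_ξ`-admissible
families of intervals have norms adding up to at most `d + 1`. If all vectors in a suitable block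
subspace failed this, a block sequence in it without `d * δ`-`ℓ₁^ζ` subsequences would contradict
the lower estimate of order `ξ + ζ`. -/
lemma exists_sum_norm_ivl_le {U : Submodule ℝ X} (hU : HasBlocks b U) {d : ℝ} (hd : 0 < d)
    {ξ ζ : ℕ} (hM : ξ + ζ ≤ M)
    (htau : ∀ u : ℕ → X, IsBlockBasis b.basis u → tau u (d * δ) < (ζ : ℕ∞)) :
    ∃ v ∈ U, ‖v‖ = 1 ∧ ∀ (t : ℕ → ℕ) (r : ℕ), StrictMono t →
      (Finset.range r).image (fun l => t l + 1) ∈ schreier ξ →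
      ∑ l ∈ Finset.range r, ‖ivl b (t l) (t (l + 1)) v‖ ≤ d + 1 := by
  classical
  have hδ := hA.1
  obtain ⟨s, W, hs, hs2, hWU, hW, hsp⟩ := exists_sparse_subspace hU
  set K : ℝ := (1 + δ⁻¹) ^ ξ with hK
  have hK0 : 0 < K := by positivity
  -- Removing the cut pieces changes the admissible sums by at most `K * ε ≤ 1 / 2`, and the
  -- combinations by at most `δ / 2` times the sum of the moduli of the coefficients.
  set ε : ℝ := min (1 / (2 * K)) (δ / 2) with hε
  have hε0 : 0 < ε := by positivity
  have hKε : K * ε ≤ 1 / 2 := by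
    calc K * ε ≤ K * (1 / (2 * K)) := by gcongr; exact min_le_left _ _
      _ = 1 / 2 := by field_simp
  have hεδ : ε ≤ δ / 2 := min_le_right _ _
  obtain ⟨z, A, hAm, hzW, hz1, hzs, hzflat⟩ := exists_seq_isFlat hnorm hA hb hW hs ξ hε0
  have hz0 : ∀ i, z i ≠ 0 := fun i h => by
    have := hz1 i
    rw [h, norm_zero] at this
    exact zero_ne_one this
  have hsA : StrictMono fun i => s (A i) := hs.comp hAm
  have hzb : IsBlockBasis b.basis z := isBlockBasis_of_ivl hsA.monotone hz0 hzs
  obtain ⟨v, hv, hv1, F, hF, a, hlt⟩ :=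
    exists_norm_sum_lt_of_tau_lt (mul_pos hd hδ) (htau z hzb)
  obtain ⟨m, hm, hvm⟩ := exists_intervals_of_isBlockBasis hsA hzs hv
  have hvW : ∀ i, v i ∈ W := fun i => by
    obtain ⟨-, F, a, h⟩ := hvm i
    rw [h]
    exact W.sum_mem fun l _ => W.smul_mem _ (hzW l)
  have hvflat : ∀ i, IsFlat b s ξ ε (v i) := fun i => by
    obtain ⟨-, F, a, h⟩ := hvm i
    have h1 := hv1 i
    rw [h] at h1 ⊢
    exact hzflat F a h1
  by_contra! hcon
  have hbad : ∀ i, ∃ (w : X) (α : ℕ → ℕ) (t : ℕ → ℕ) (r : ℕ), StrictMono t ∧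
      (Finset.range r).image (fun l => t l + 1) ∈ schreier ξ ∧ Monotone α ∧ ‖w - v i‖ ≤ ε ∧
      (∀ c, b.coord c (v i) = 0 → b.coord c w = 0) ∧
      (∀ l, A (m i) ≤ α l ∧ α l ≤ A (m (i + 1))) ∧
      (∀ l, α l < α (l + 1) → t l ≤ s (α l)) ∧
      d + 1 / 2 ≤ ∑ l ∈ Finset.range r, ‖ivl b (s (α l)) (s (α (l + 1))) w‖ := by
    intro i
    obtain ⟨t, r, ht, htS, hbig⟩ := hcon (v i) (hWU (hvW i)) (hv1 i)
    obtain ⟨w, α, hα, hwv, hw0, hαB, htα, hsum⟩ := exists_uncut hnorm hA hb hs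
      (hAm.monotone (hm.monotone (Nat.le_succ i))) (hvm i).1 (hvflat i) ht htS
    exact ⟨w, α, t, r, ht, htS, hα, hwv, hw0, hαB, htα, by linarith⟩
  choose w α t r ht htS hα hwv hw0 hαB htα hbig using hbad
  have hF0 : ∀ i ∈ F, 0 < i := pos_of_mem_schreier hF
  have key := mul_sum_sum_norm_ivl_le hnorm hA hb hs hs2 hM hF
    (B := fun i => A (m (i - 1))) (B' := fun i => A (m (i - 1 + 1)))
    (w := fun i => a i • w (i - 1)) (α := fun i => α (i - 1)) (r := fun i => r (i - 1))
    (t := fun i => t (i - 1)) (fun i _ => ?_) (fun i hi j hj hij => ?_) (fun i _ => ?_)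
    (fun i _ c x h1 h2 => ?_) (fun i _ => hα _) (fun i _ => hαB _) (fun i _ => ht _)
    (fun i _ => htS _) (fun i _ => htα _)
  · simp only [map_smul, norm_smul, Real.norm_eq_abs, ← Finset.mul_sum] at key
    have h1 : (d + 1 / 2) * ∑ i ∈ F, |a i| ≤ ∑ i ∈ F, |a i| * ∑ l ∈ Finset.range (r (i - 1)),
        ‖ivl b (s (α (i - 1) l)) (s (α (i - 1) (l + 1))) (w (i - 1))‖ := by
      rw [Finset.mul_sum]
      refine Finset.sum_le_sum fun i _ => ?_
      rw [mul_comm]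
      exact mul_le_mul_of_nonneg_left (hbig (i - 1)) (abs_nonneg _)
    have h2 : ‖∑ i ∈ F, a i • w (i - 1)‖ ≤
        ‖∑ i ∈ F, a i • v (i - 1)‖ + ε * ∑ i ∈ F, |a i| := by
      have h3 : ∑ i ∈ F, a i • w (i - 1) =
          ∑ i ∈ F, a i • v (i - 1) + ∑ i ∈ F, a i • (w (i - 1) - v (i - 1)) := by
        rw [← Finset.sum_add_distrib]
        exact Finset.sum_congr rfl fun i _ => by rw [smul_sub]; abel
      rw [h3, Finset.mul_sum]
      refine (norm_add_le _ _).trans (add_le_add le_rfl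
        ((norm_sum_le _ _).trans (Finset.sum_le_sum fun i _ => ?_)))
      rw [norm_smul, Real.norm_eq_abs, mul_comm]
      exact mul_le_mul_of_nonneg_right (hwv _) (abs_nonneg _)
    have hS : 0 ≤ ∑ i ∈ F, |a i| := Finset.sum_nonneg fun _ _ => abs_nonneg _
    have h4 := mul_le_mul_of_nonneg_left h1 hδ.le
    have h5 := mul_le_mul_of_nonneg_right hεδ hS
    linarith
  · have h1 : i - 1 ≤ A (m (i - 1)) := (hAm.comp hm).le_apply
    omega
  · have := hF0 i hi
    exact hAm.monotone (hm.monotone (by omega))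
  · rw [map_smul]
    congr 1
    refine (ivl_eq_self_iff b).2 fun c hc => hw0 _ c ?_
    exact (ivl_eq_self_iff b).1 (hvm (i - 1)).1 c hc
  · rw [map_smul, hw0 _ x (hsp _ (hvW _) c x h1 h2), smul_zero]

end GoodVector

section DistortingNorm

variable {X : Type*} [NormedAddCommGroup X] [NormedSpace ℝ X] {b : SchauderBasis ℝ X}

lemma zero_mem_admissibleSums (δ : ℝ) (ξ : ℕ) : (0 : StrongDual ℝ X) ∈ admissibleSums b δ ξ := by
  refine ⟨0, fun i => i.elim0, fun i => i.elim0, ⟨fun i => i.elim0, fun i => i.elim0,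
    ⟨fun i => i.elim0, fun i => i.elim0, 0, fun i => i.elim0⟩, ?_⟩, by simp⟩
  simpa using empty_mem_schreier ξ

lemma neg_mem_admissibleSums {δ : ℝ} {ξ : ℕ} {f : StrongDual ℝ X}
    (hf : f ∈ admissibleSums b δ ξ) : -f ∈ admissibleSums b δ ξ := by
  obtain ⟨k, g, hg, ⟨F, hF, ⟨h1, h2, a, ha⟩, hS⟩, rfl⟩ := hf
  refine ⟨k, fun i => -g i, fun i => by rw [norm_neg]; exact hg i,
    ⟨F, hF, ⟨h1, h2, fun l => -a l, fun i => ⟨fun l hl => neg_ne_zero.2 ((ha i).1 l hl), ?_⟩⟩, hS⟩,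
    by rw [Finset.sum_neg_distrib, smul_neg]⟩
  simp only [(ha i).2, neg_smul, Finset.sum_neg_distrib]

/-- A bound for the admissible sums bounds the distorting norm. -/
lemma distortingNorm_le {δ C : ℝ} (hδ : 0 < δ) {ξ : ℕ} {x : X}
    (h : ∀ (t : ℕ → ℕ) (r : ℕ), StrictMono t →
      (Finset.range r).image (fun l => t l + 1) ∈ schreier ξ →
      ∑ l ∈ Finset.range r, ‖ivl b (t l) (t (l + 1)) x‖ ≤ C) :
    (∀ f ∈ admissibleSums b δ ξ, f x ≤ δ * C) ∧
      distortingNorm b δ ξ x ≤ δ * ‖x‖ + δ * C := by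
  have h1 : ∀ f ∈ admissibleSums b δ ξ, f x ≤ δ * C := by
    rintro _ ⟨k, g, hg, hadm, rfl⟩
    obtain ⟨t, ht, htS, hgx⟩ := exists_cuts_of_isAdmissible hg hadm
    simp only [smul_apply, sum_apply, smul_eq_mul]
    exact mul_le_mul_of_nonneg_left ((hgx x).trans (h t k ht htS)) hδ.le
  refine ⟨h1, add_le_add le_rfl (csSup_le ⟨_, Set.mem_image_of_mem _
    (zero_mem_admissibleSums δ ξ)⟩ ?_)⟩
  rintro _ ⟨f, hf, rfl⟩
  exact h1 f hf

lemma sum_norm_ivl_le (hnorm : IsNormalizedSeq b.basis) (hb : IsBimonotone b) {δ : ℝ} {M : ℕ}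
    (hA : IsAsymptoticEll1 b.basis δ M) {ξ : ℕ} (x : X) {t : ℕ → ℕ} {r : ℕ} (ht : StrictMono t)
    (htS : (Finset.range r).image (fun l => t l + 1) ∈ schreier ξ) :
    ∑ l ∈ Finset.range r, ‖ivl b (t l) (t (l + 1)) x‖ ≤ (1 + δ⁻¹) ^ ξ * ‖x‖ :=
  sum_norm_ivl_le_of_mem_schreier hnorm hA hb ht
    (image_mem_schreier_of_le (f := fun l => t l + 1) (fun _ _ _ _ h => Nat.succ_lt_succ (ht h))
      (fun _ _ _ _ h => ht (Nat.succ_lt_succ h)) (fun l _ => ht (Nat.lt_add_one l)) htS) x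

lemma bddAbove_admissibleSums (hnorm : IsNormalizedSeq b.basis) (hb : IsBimonotone b) {δ : ℝ}
    {M : ℕ} (hA : IsAsymptoticEll1 b.basis δ M) (ξ : ℕ) (x : X) :
    BddAbove ((fun f : StrongDual ℝ X => f x) '' admissibleSums b δ ξ) := by
  refine ⟨δ * ((1 + δ⁻¹) ^ ξ * ‖x‖), ?_⟩
  rintro _ ⟨f, hf, rfl⟩
  exact (distortingNorm_le hA.1 fun t r ht htS => sum_norm_ivl_le hnorm hb hA x ht htS).1 f hf

lemma isEquivalentNorm_distortingNorm (hnorm : IsNormalizedSeq b.basis) (hb : IsBimonotone b)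
    {δ : ℝ} {M : ℕ} (hA : IsAsymptoticEll1 b.basis δ M) (ξ : ℕ) :
    IsEquivalentNorm (distortingNorm b δ ξ) := by
  have hδ := hA.1
  have hbdd := bddAbove_admissibleSums hnorm hb hA ξ
  have hne : ∀ x : X, ((fun f : StrongDual ℝ X => f x) '' admissibleSums b δ ξ).Nonempty :=
    fun x => ⟨_, Set.mem_image_of_mem _ (zero_mem_admissibleSums δ ξ)⟩
  have hle : ∀ x : X, ∀ f ∈ admissibleSums b δ ξ,
      f x ≤ sSup ((fun f : StrongDual ℝ X => f x) '' admissibleSums b δ ξ) :=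
    fun x f hf => le_csSup (hbdd x) ⟨f, hf, rfl⟩
  have hsmul : ∀ (c : ℝ) (x : X), distortingNorm b δ ξ (c • x) ≤ |c| * distortingNorm b δ ξ x := by
    intro c x
    unfold distortingNorm
    rw [norm_smul, Real.norm_eq_abs, mul_add]
    refine add_le_add (by ring_nf; exact le_rfl) (csSup_le (hne _) ?_)
    rintro _ ⟨f, hf, rfl⟩
    simp only [map_smul, smul_eq_mul]
    rcases abs_choice c with h | h
    · rw [h]
      exact mul_le_mul_of_nonneg_left (hle x f hf) (h ▸ abs_nonneg c)
    · have := mul_le_mul_of_nonneg_left (hle x _ (neg_mem_admissibleSums hf)) (abs_nonneg c)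
      rw [neg_apply, mul_neg, ← neg_mul] at this
      rwa [show c = -|c| by rw [h, neg_neg], abs_neg, abs_abs]
  refine ⟨fun x y => ?_, fun c x => le_antisymm (hsmul c x) ?_, ⟨δ, hδ, fun x => ?_⟩,
    ⟨δ + δ * (1 + δ⁻¹) ^ ξ, by positivity, fun x => ?_⟩⟩
  · have h : sSup ((fun f : StrongDual ℝ X => f (x + y)) '' admissibleSums b δ ξ) ≤
        sSup ((fun f : StrongDual ℝ X => f x) '' admissibleSums b δ ξ) +
        sSup ((fun f : StrongDual ℝ X => f y) '' admissibleSums b δ ξ) := by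
      refine csSup_le (hne _) ?_
      rintro _ ⟨f, hf, rfl⟩
      simp only [map_add]
      exact add_le_add (hle x f hf) (hle y f hf)
    have h' := mul_le_mul_of_nonneg_left (norm_add_le x y) hδ.le
    unfold distortingNorm
    linarith
  · rcases eq_or_ne c 0 with rfl | hc
    · have := hsmul 0 (0 : X)
      rw [abs_zero, zero_mul, zero_smul]
      unfold distortingNorm
      rw [norm_zero, mul_zero, zero_add]
      exact (hle 0 0 (zero_mem_admissibleSums δ ξ))
    · have := hsmul c⁻¹ (c • x)
      rw [smul_smul, inv_mul_cancel₀ hc, one_smul, abs_inv, ← div_eq_inv_mul,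
        le_div_iff₀ (abs_pos.2 hc)] at this
      rwa [mul_comm]
  · have := hle x 0 (zero_mem_admissibleSums δ ξ)
    rw [zero_apply] at this
    unfold distortingNorm
    linarith
  · have := (distortingNorm_le hδ fun t r ht htS =>
      sum_norm_ivl_le hnorm hb hA (ξ := ξ) x ht htS).2
    linarith

/-- Combinations witnessing the failure of a `d * δ`-`ℓ₁^p` estimate have large distorting norm:
the functionals norming their terms form an admissible sequence. -/
lemma exists_le_distortingNorm (hnorm : IsNormalizedSeq b.basis) (hb : IsBimonotone b) {δ : ℝ}
    {M : ℕ} (hA : IsAsymptoticEll1 b.basis δ M) {d : ℝ} (hd : 0 < d) {p ξ : ℕ} (hp : p ≤ ξ)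
    {u : ℕ → X} {N : ℕ → ℕ} (hN : StrictMono N)
    (hu : ∀ i, ivl b (N i) (N (i + 1)) (u i) = u i) (htau : tau u (d * δ) < (p : ℕ∞)) :
    ∃ x ∈ Submodule.span ℝ (Set.range u), x ≠ 0 ∧ ‖x‖ ≤ d * distortingNorm b δ ξ x := by
  classical
  have hδ := hA.1
  obtain ⟨v, hv, hv1, F, hF, a, hlt⟩ := exists_norm_sum_lt_of_tau_lt (mul_pos hd hδ) htau
  obtain ⟨m, hm, hvm⟩ := exists_intervals_of_isBlockBasis hN hu hv
  have hF0 : ∀ i ∈ F, 0 < i := pos_of_mem_schreier hF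
  set x : X := ∑ i ∈ F, a i • v (i - 1) with hx
  have hS : 0 < ∑ i ∈ F, |a i| := by
    by_contra h
    have h1 : d * δ * ∑ i ∈ F, |a i| ≤ 0 :=
      mul_nonpos_of_nonneg_of_nonpos (mul_pos hd hδ).le (not_lt.1 h)
    linarith [norm_nonneg x]
  have hNm : StrictMono fun i => N (m i) := hN.comp hm
  -- `g i` norms `a i • v (i - 1)`; the sign is chosen to be `±1` even if `a i = 0`.
  have hφ : ∀ i, ∃ φ : StrongDual ℝ X, ‖φ‖ ≤ 1 ∧ φ (v (i - 1)) = if a i < 0 then -1 else 1 := by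
    intro i
    obtain ⟨φ, hφ1, hφv⟩ := exists_dual_vector'' ℝ (v (i - 1))
    rw [hv1 (i - 1)] at hφv
    split_ifs
    · exact ⟨-φ, by rwa [norm_neg], by rw [neg_apply, hφv]; simp⟩
    · exact ⟨φ, hφ1, by rw [hφv]; simp⟩
  choose φ hφ1 hφv using hφ
  set g : ℕ → StrongDual ℝ X := fun i =>
    (φ i).comp (ivl b (N (m (i - 1))) (N (m (i - 1 + 1)))) with hg
  have hgv : ∀ i, g i (v (i - 1)) = if a i < 0 then -1 else 1 := fun i => by
    rw [hg, ContinuousLinearMap.comp_apply, (hvm _).1, hφv]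
  have hgne : ∀ i, g i ≠ 0 := fun i h => by
    have := hgv i
    rw [h, zero_apply] at this
    split_ifs at this <;> norm_num at this
  have hg1 : ∀ i, ‖g i‖ ≤ 1 := fun i => by
    refine ContinuousLinearMap.opNorm_le_bound _ zero_le_one fun y => ?_
    calc _ ≤ 1 * ‖ivl b (N (m (i - 1))) (N (m (i - 1 + 1))) y‖ :=
          ContinuousLinearMap.le_of_opNorm_le _ (hφ1 i) _
      _ ≤ 1 * ‖y‖ := by gcongr; exact norm_ivl_le hb _ _ _
  have hgx : ∀ i ∈ F, g i x = |a i| := fun i hi => by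
    rw [hx, map_sum, Finset.sum_eq_single i]
    · rw [map_smul, hgv, smul_eq_mul]
      split_ifs with h
      · rw [abs_of_neg h]; ring
      · rw [abs_of_nonneg (not_lt.1 h), mul_one]
    · intro j hj hne
      have h0 : ivl b (N (m (i - 1))) (N (m (i - 1 + 1))) (v (j - 1)) = 0 := by
        refine ext_coord (b := b) fun c => ?_
        rw [coord_ivl, map_zero]
        split_ifs with hc
        · refine (ivl_eq_self_iff b).1 (hvm (j - 1)).1 c ?_
          have hi0 := hF0 i hi
          have hj0 := hF0 j hj
          rcases lt_or_gt_of_ne hne with h | h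
          · have := hNm.monotone (show j - 1 + 1 ≤ i - 1 by omega)
            omega
          · have := hNm.monotone (show i - 1 + 1 ≤ j - 1 by omega)
            omega
        · rfl
      rw [map_smul, hg, ContinuousLinearMap.comp_apply, h0, map_zero, smul_zero]
    · exact fun h => absurd hi h
  set H : ℕ → Finset ℕ := fun i => (Finset.Ico (N (m (i - 1))) (N (m (i - 1 + 1)))).filter
    fun c => φ i (b.basis c) ≠ 0 with hH
  have hgH : ∀ i, g i = ∑ c ∈ H i, φ i (b.basis c) • b.coord c := fun i => by
    ext y
    rw [hg, ContinuousLinearMap.comp_apply, ivl_apply, map_sum, sum_apply, hH,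
      Finset.sum_filter_of_ne]
    · exact Finset.sum_congr rfl fun c _ => by
        rw [map_smul, smul_apply, smul_eq_mul, smul_eq_mul, mul_comm]
    · intro c _ hc h0
      exact hc (by rw [smul_apply, h0, zero_smul])
  have hHne : ∀ i, (H i).Nonempty := fun i => by
    rw [Finset.nonempty_iff_ne_empty]
    intro h0
    exact hgne i (by rw [hgH i, h0, Finset.sum_empty])
  have hHlt : ∀ i ∈ F, ∀ j ∈ F, i < j → ∀ s ∈ H i, ∀ t ∈ H j, s < t := by
    intro i hi j hj hij s hs t ht
    have h1 := Finset.mem_Ico.1 (Finset.mem_filter.1 hs).1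
    have h2 := Finset.mem_Ico.1 (Finset.mem_filter.1 ht).1
    have h3 := hNm.monotone (show i - 1 + 1 ≤ j - 1 by have := hF0 i hi; omega)
    omega
  set I := F.orderEmbOfFin rfl with hI
  have hIF : ∀ i, I i ∈ F := fun i => F.orderEmbOfFin_mem rfl i
  have hadm : IsAdmissible b ξ fun i : Fin F.card => g (I i) := by
    refine ⟨fun i => H (I i), fun i => hHne _, isBlockSeqOn_of_coeff (fun i => hHne _)
      (fun i j hij => hHlt _ (hIF i) _ (hIF j) (I.strictMono hij))
      (fun i l hl => (Finset.mem_filter.1 hl).2) fun i => hgH _, ?_⟩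
    have h1 : F.image (fun i => (H i).min' (hHne i) + 1) ∈ schreier p := by
      refine image_mem_schreier_of_le (f := id) (strictMono_id.strictMonoOn _)
        (fun i hi j hj hij => Nat.succ_lt_succ ?_) (fun i hi => ?_) (by rwa [Finset.image_id])
      · exact hHlt i hi j hj hij _ (Finset.min'_mem _ _) _ (Finset.min'_mem _ _)
      · have h1 := Finset.mem_Ico.1 (Finset.mem_filter.1 (Finset.min'_mem _ (hHne i))).1
        have h2 : i - 1 ≤ N (m (i - 1)) := hNm.le_apply
        simp only [id]
        omega
    have h2 : Finset.univ.image (fun i : Fin F.card => (H (I i)).min' (hHne _) + 1) =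
        F.image fun i => (H i).min' (hHne i) + 1 := by
      conv_rhs => rw [← Finset.image_orderEmbOfFin_univ F rfl, Finset.image_image]
      rfl
    rw [h2]
    exact schreier_le hp h1
  have hsum : ∑ i : Fin F.card, g (I i) x = ∑ i ∈ F, |a i| := by
    rw [← Finset.sum_congr rfl hgx]
    conv_rhs => rw [← Finset.image_orderEmbOfFin_univ F rfl]
    rw [Finset.sum_image fun i _ j _ h => (F.orderEmbOfFin rfl).injective h]
  have hq : δ * ∑ i ∈ F, |a i| ≤ distortingNorm b δ ξ x := by
    have h1 := le_csSup (bddAbove_admissibleSums hnorm hb hA ξ x)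
      ⟨_, ⟨F.card, fun i => g (I i), fun i => hg1 _, hadm, rfl⟩, rfl⟩
    simp only [smul_apply, sum_apply, smul_eq_mul, hsum] at h1
    have h2 : 0 ≤ δ * ‖x‖ := by positivity
    unfold distortingNorm
    linarith
  refine ⟨x, ?_, fun h0 => ?_, ?_⟩
  · refine Submodule.sum_mem _ fun i _ => Submodule.smul_mem _ _ ?_
    obtain ⟨-, G, c, h⟩ := hvm (i - 1)
    rw [h]
    exact Submodule.sum_mem _ fun l _ => Submodule.smul_mem _ _ (Submodule.subset_span ⟨l, rfl⟩)
  · have : ∑ i ∈ F, |a i| = 0 := by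
      rw [← hsum, h0]
      simp
    linarith
  · calc ‖x‖ ≤ d * δ * ∑ i ∈ F, |a i| := hlt.le
      _ = d * (δ * ∑ i ∈ F, |a i|) := by ring
      _ ≤ _ := by gcongr

end DistortingNorm

/-! ### From block subspaces to arbitrary subspaces -/

section Perturbation

variable {X : Type*} [NormedAddCommGroup X] [NormedSpace ℝ X] {b : SchauderBasis ℝ X}

lemma exists_ne_zero_coord_eq_zero {Y : Submodule ℝ X} (hY : ¬ FiniteDimensional ℝ Y) (N : ℕ) :
    ∃ y ∈ Y, y ≠ 0 ∧ ∀ i < N, b.coord i y = 0 := by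
  let T : Y →ₗ[ℝ] (Fin N → ℝ) :=
    LinearMap.pi fun i => (b.coord i).toLinearMap.comp Y.subtype
  have hT : ¬ Function.Injective T := fun h => hY (FiniteDimensional.of_injective T h)
  rw [← LinearMap.ker_eq_bot, ← ne_eq, Submodule.ne_bot_iff] at hT
  obtain ⟨y, hy, hy0⟩ := hT
  refine ⟨y, y.2, fun h => hy0 (Subtype.ext h), fun i hi => ?_⟩
  exact congrFun (LinearMap.mem_ker.1 hy) ⟨i, hi⟩

/-- Gliding hump: an infinite-dimensional subspace contains small perturbations of a normalized
block sequence. -/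
lemma exists_block_seq_near (hb : IsBimonotone b) {Y : Submodule ℝ X}
    (hY : ¬ FiniteDimensional ℝ Y) {η : ℝ} (hη : 0 < η) :
    ∃ (u : ℕ → X) (N : ℕ → ℕ), StrictMono N ∧ (∀ i, ‖u i‖ = 1) ∧
      (∀ i, ivl b (N i) (N (i + 1)) (u i) = u i) ∧
      ∀ v ∈ Submodule.span ℝ (Set.range u), ‖v‖ = 1 → ∃ y ∈ Y, ‖v - y‖ ≤ η := by
  -- The pairs consist of a block vector and of a vector of `Y` close to it.
  obtain ⟨z, N, -, hN, hz⟩ := exists_seq_of_step (α := X × X)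
    (Q := fun i a z a' => ‖z.1‖ = 1 ∧ ivl b a a' z.1 = z.1 ∧ z.2 ∈ Y ∧
      ‖z.1 - z.2‖ ≤ η / 2 / 2 ^ i) 0 fun i a => by
    obtain ⟨y, hyY, hy0, hya⟩ := exists_ne_zero_coord_eq_zero (b := b) hY a
    have hlim : Tendsto (fun n => ‖SchauderBasis.proj b n y‖⁻¹ * ‖SchauderBasis.proj b n y - y‖)
        atTop (𝓝 (‖y‖⁻¹ * ‖y - y‖)) := by
      have h1 := SchauderBasis.tendsto_proj b y
      exact (h1.norm.inv₀ (norm_ne_zero_iff.2 hy0)).mul (h1.sub_const y).norm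
    rw [sub_self, norm_zero, mul_zero] at hlim
    have hpos : 0 < η / 2 / 2 ^ i := by positivity
    have hne : ∀ᶠ n in atTop, SchauderBasis.proj b n y ≠ 0 :=
      (SchauderBasis.tendsto_proj b y).eventually_ne hy0
    obtain ⟨n, hn1, hn2, hn3⟩ :=
      ((hlim.eventually_le_const hpos).and (hne.and (eventually_gt_atTop a))).exists
    have hproj : ivl b a n (SchauderBasis.proj b n y) = SchauderBasis.proj b n y := by
      refine (ivl_eq_self_iff b).2 fun c hc => ?_
      rw [proj_eq_ivl, coord_ivl]
      split_ifs with h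
      · exact hya c (by omega)
      · rfl
    have hn0 := norm_ne_zero_iff.2 hn2
    refine ⟨(‖SchauderBasis.proj b n y‖⁻¹ • SchauderBasis.proj b n y,
      ‖SchauderBasis.proj b n y‖⁻¹ • y), n, hn3, ?_, ?_, Y.smul_mem _ hyY, ?_⟩
    · rw [norm_smul, norm_inv, norm_norm, inv_mul_cancel₀ hn0]
    · rw [map_smul, hproj]
    · rw [← smul_sub, norm_smul, norm_inv, norm_norm]
      exact hn1
  refine ⟨fun i => (z i).1, N, hN, fun i => (hz i).1, fun i => (hz i).2.1, fun v hv hv1 => ?_⟩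
  obtain ⟨c, rfl⟩ := (Finsupp.mem_span_range_iff_exists_finsupp).1 hv
  refine ⟨c.sum fun i a => a • (z i).2, Y.sum_mem fun i _ => Y.smul_mem _ (hz i).2.2.1, ?_⟩
  unfold Finsupp.sum at hv1 ⊢
  rw [← Finset.sum_sub_distrib]
  calc ‖∑ i ∈ c.support, (c i • (z i).1 - c i • (z i).2)‖
      ≤ ∑ i ∈ c.support, η / 2 / 2 ^ i := by
        refine (norm_sum_le _ _).trans (Finset.sum_le_sum fun i hi => ?_)
        rw [← smul_sub, norm_smul, Real.norm_eq_abs]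
        have h1 := abs_coeff_le_norm hb hN.monotone (fun i => (hz i).2.1) (fun i => (hz i).1)
          c.support c hi
        rw [hv1] at h1
        exact (mul_le_of_le_one_left (norm_nonneg _) h1).trans (hz i).2.2.2
    _ ≤ ∑' i : ℕ, η / 2 / 2 ^ i :=
        (summable_geometric_two' η).sum_le_tsum _ fun i _ => by positivity
    _ = η := tsum_geometric_two' η

lemma hasBlocks_span {u : ℕ → X} {N : ℕ → ℕ} (hN : StrictMono N) (hu1 : ∀ i, ‖u i‖ = 1)
    (hu : ∀ i, ivl b (N i) (N (i + 1)) (u i) = u i) :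
    HasBlocks b (Submodule.span ℝ (Set.range u)) := fun n => by
  refine ⟨u n, Submodule.subset_span ⟨n, rfl⟩, fun h => ?_, N (n + 1),
    ivl_mono_self b (hu n) hN.le_apply le_rfl⟩
  have := hu1 n
  rw [h, norm_zero] at this
  exact zero_ne_one this

/-- An equivalent norm distorts `X` if, in every block subspace, its values on the unit sphere
include values `≥ A` and values `≤ B`, with `r * B < A`. -/
lemma distortsBy_of_blocks (hb : IsBimonotone b) {q : X → ℝ} (hq : IsEquivalentNorm q)
    {A B r : ℝ} (hr : 0 ≤ r) (hAB : r * B < A)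
    (h : ∀ (u : ℕ → X) (N : ℕ → ℕ), StrictMono N → (∀ i, ‖u i‖ = 1) →
      (∀ i, ivl b (N i) (N (i + 1)) (u i) = u i) →
      (∃ x ∈ Submodule.span ℝ (Set.range u), ‖x‖ = 1 ∧ A ≤ q x) ∧
      ∃ y ∈ Submodule.span ℝ (Set.range u), ‖y‖ = 1 ∧ q y ≤ B) : DistortsBy r q := by
  intro Y hY
  obtain ⟨C, hC, hqC⟩ := hq.upper
  obtain ⟨c, hc, hqc⟩ := hq.lower
  have hlip : ∀ x y, q x ≤ q y + C * ‖x - y‖ := fun x y => by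
    have h1 := hq.add_le (x - y) y
    rw [sub_add_cancel] at h1
    linarith [hqC (x - y)]
  have hq0 : ∀ x, 0 ≤ q x := fun x => (mul_nonneg hc.le (norm_nonneg x)).trans (hqc x)
  have hlim : Tendsto (fun η : ℝ => (A - C * η) * (1 - η) - r * ((B + C * η) * (1 + η)))
      (𝓝[>] 0) (𝓝 ((A - C * 0) * (1 - 0) - r * ((B + C * 0) * (1 + 0)))) :=
    Tendsto.mono_left (Continuous.tendsto (by fun_prop) 0) nhdsWithin_le_nhds
  have hpos : 0 < (A - C * 0) * (1 - 0) - r * ((B + C * 0) * (1 + 0)) := by linarith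
  have hpos' : ∀ᶠ η : ℝ in 𝓝[>] 0, η ∈ Set.Ioi (0 : ℝ) := self_mem_nhdsWithin
  have hpos' : ∀ᶠ η : ℝ in 𝓝[>] 0, η ∈ Set.Ioi (0 : ℝ) := self_mem_nhdsWithin
  have hsmall : ∀ᶠ η : ℝ in 𝓝[>] 0, η < 1 :=
    nhdsWithin_le_nhds (eventually_lt_nhds one_pos)
  obtain ⟨η, hη, hη0, hη1⟩ :=
    ((hlim.eventually_const_lt hpos).and (hpos'.and hsmall)).exists
  rw [Set.mem_Ioi] at hη0
  obtain ⟨u, N, hN, hu1, hu, hnear⟩ := exists_block_seq_near hb hY hη0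
  obtain ⟨⟨x, hxU, hx1, hqx⟩, y, hyU, hy1, hqy⟩ := h u N hN hu1 hu
  obtain ⟨x', hx'Y, hx'⟩ := hnear x hxU hx1
  obtain ⟨y', hy'Y, hy'⟩ := hnear y hyU hy1
  have hnx : ‖x'‖ ≤ 1 + η := by
    have := norm_sub_norm_le x' x
    rw [norm_sub_rev] at this
    linarith
  have hnx0 : 0 < ‖x'‖ := by
    have := norm_sub_norm_le x x'
    linarith
  have hny : 1 - η ≤ ‖y'‖ := by
    have := norm_sub_norm_le y y'
    linarith
  have hny0 : 0 < ‖y'‖ := by linarith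
  have hqx' : A - C * η ≤ q x' := by
    have h1 := hlip x x'
    have h2 := mul_le_mul_of_nonneg_left hx' hC.le
    linarith
  have hqy' : q y' ≤ B + C * η := by
    have h1 := hlip y' y
    rw [norm_sub_rev] at h1
    have h2 := mul_le_mul_of_nonneg_left hy' hC.le
    linarith
  refine ⟨‖x'‖⁻¹ • x', Y.smul_mem _ hx'Y, ‖y'‖⁻¹ • y', Y.smul_mem _ hy'Y,
    smul_ne_zero (inv_ne_zero hnx0.ne') (norm_pos_iff.1 hnx0),
    smul_ne_zero (inv_ne_zero hny0.ne') (norm_pos_iff.1 hny0), ?_, ?_⟩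
  · rw [norm_smul, norm_smul, norm_inv, norm_inv, norm_norm, norm_norm,
      inv_mul_cancel₀ hnx0.ne', inv_mul_cancel₀ hny0.ne']
  · have hqy0 : 0 < q y' := lt_of_lt_of_le (mul_pos hc hny0) (hqc y')
    rw [hq.smul, hq.smul, abs_inv, abs_inv, abs_norm, abs_norm,
      lt_div_iff₀ (mul_pos (inv_pos.2 hny0) hqy0), ← div_eq_inv_mul, ← div_eq_inv_mul,
      ← mul_div_assoc, div_lt_div_iff₀ hny0 hnx0]
    calc r * q y' * ‖x'‖ ≤ r * ((B + C * η) * (1 + η)) := by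
          rw [mul_assoc]
          exact mul_le_mul_of_nonneg_left (mul_le_mul hqy' hnx hnx0.le
            (hqy0.le.trans hqy')) hr
      _ < (A - C * η) * (1 - η) := by linarith
      _ ≤ q x' * (1 - η) := mul_le_mul_of_nonneg_right hqx' (by linarith)
      _ ≤ q x' * ‖y'‖ := mul_le_mul_of_nonneg_left hny (hq0 _)

end Perturbation

theorem theorem3p1 {X : Type*} [NormedAddCommGroup X] [NormedSpace ℝ X] [CompleteSpace X]
    (b : SchauderBasis ℝ X) (hnorm : IsNormalizedSeq b.basis) (hshr : IsShrinking b)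
    (hbim : IsBimonotone b) (d : ℝ) (n p : ℕ → ℕ) (δ : ℕ → ℝ)
    (hdist : DistortionProperty b d n p δ) :
    IsArbitrarilyDistortable X ∧
    (∀ j, (∀ x : X, BddAbove
        ((fun f : StrongDual ℝ X => f x) '' admissibleSums b (δ j) (n j))) ∧
      IsEquivalentNorm (distortingNorm b (δ j) (n j))) ∧
    (∀ r : ℝ, 1 < r → ∀ᶠ j in atTop, DistortsBy r (distortingNorm b (δ j) (n j))) := by
  have hA := hdist.asymptotic
  have hd : 0 < d := one_pos.trans hdist.one_lt_d
  have hequiv : ∀ j, IsEquivalentNorm (distortingNorm b (δ j) (n j)) := fun j =>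
    isEquivalentNorm_distortingNorm hnorm hbim (hA j) (n j)
  have hdistorts : ∀ r : ℝ, 1 < r →
      ∀ᶠ j in atTop, DistortsBy r (distortingNorm b (δ j) (n j)) := by
    intro r hr
    have hlim : Tendsto (fun j => r * (δ j * (d + 2))) atTop (𝓝 (r * (0 * (d + 2)))) :=
      (hdist.tendsto_δ.mul_const _).const_mul _
    rw [zero_mul, mul_zero] at hlim
    filter_upwards [hlim.eventually_lt_const (show (0 : ℝ) < 1 / d by positivity)] with j hj
    refine distortsBy_of_blocks hbim (hequiv j) (by linarith) hj fun u N hN hu1 hu => ⟨?_, ?_⟩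
    · have hu0 : ∀ i, u i ≠ 0 := fun i h => by
        have := hu1 i
        rw [h, norm_zero] at this
        exact zero_ne_one this
      obtain ⟨x, hxU, hx0, hx⟩ := exists_le_distortingNorm hnorm hbim (hA j) hd
        (show p j ≤ n j by have := hdist.two_mul_p_lt_n j; omega) hN hu
        (hdist.tau_lt j u (isBlockBasis_of_ivl hN.monotone hu0 hu))
      have hx' := norm_pos_iff.2 hx0
      refine ⟨‖x‖⁻¹ • x, Submodule.smul_mem _ _ hxU, ?_, ?_⟩
      · rw [norm_smul, norm_inv, norm_norm, inv_mul_cancel₀ hx'.ne']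
      · rw [(hequiv j).smul, abs_inv, abs_norm, ← div_eq_inv_mul, div_le_div_iff₀ hd hx', one_mul,
          mul_comm]
        exact hx
    · -- The asymptotic estimate with index `j + 1` controls admissible families of order `n j`.
      obtain ⟨y, hyU, hy1, hy⟩ := exists_sum_norm_ivl_le hnorm (hA (j + 1)) hbim
        (hasBlocks_span hN hu1 hu) hd (ξ := n j) (ζ := p (j + 1))
        (by have := hdist.two_mul_p_lt_n (j + 1); have := hdist.n_le_p_succ j; omega)
        (hdist.tau_lt (j + 1))
      refine ⟨y, hyU, hy1, (distortingNorm_le (hA j).1 hy).2.trans ?_⟩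
      rw [hy1]
      exact le_of_eq (by ring)
  refine ⟨fun r hr => ?_, fun j => ⟨bddAbove_admissibleSums hnorm hbim (hA j) (n j), hequiv j⟩,
    hdistorts⟩
  obtain ⟨j, hj⟩ := (hdistorts r hr).exists
  exact ⟨_, hequiv j, hj⟩
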